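/- **Setting.** Fix a finite set $\mathcal I$ of information sets and, for each $I\in\mathcal I$, a finite non-empty set $\mathrm{Act}(I)$ of actions; the sets $\mathrm{Act}(I)$ are pairwise disjoint and $A=\biguplus_{I}\mathrm{Act}(I)$. A (one-player) *game structure* $\mathcal T$ over $(\mathcal I,\mathrm{Act})$ is a finite rooted tree each of whose internal nodes is either a chance node, with at least one child, or a player node, which belongs to an information set $I\in\mathcal I$ and has exactly one outgoing edge labelled $a$ for each $a\in\mathrm{Act}(I)$. The size $|\mathcal T|$ is the number of leaves of $\mathcal T$. The history $\mathrm{hist}(v)$ of a node $v$ is the sequence of player actions on the path from the root to $v$. $\mathcal T$ is *non-absentminded* if on every path from the root to a leaf the player nodes lie in distinct information sets. $\mathcal T$ has *A-loss recall* if for any two distinct nodes $u,v$ of the same information set either $\mathrm{hist}(u)=\mathrm{hist}(v)$, or $\mathrm{hist}(u)=s\,a\,s_1$ and $\mathrm{hist}(v)=s\,b\,s_2$ with $a\ne b$, $a,b\in\mathrm{Act}(I')$ for some $I'\in\mathcal I$. $\mathcal T$ has *shuffled A-loss recall* (S-ALR) if there is a game structure $\mathcal T'$ over $(\mathcal I,\mathrm{Act})$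 with $|\mathcal T'|=|\mathcal T|$ that has A-loss recall and admits a bijection $f$ from the leaves of $\mathcal T$ to the leaves of $\mathcal T'$ such that $\mathrm{hist}(f(t))$ is a permutation of $\mathrm{hist}(t)$ for every leaf $t$; such a $\mathcal T'$ is called an *S-ALR witness* of $\mathcal T$. **Theorem.** There are a single algorithm (a program in first-order pure Lisp, with unit cost per evaluation step; the structure is given as an S-expression with information sets numbered in unary) and a polynomial $p$ with the following property. For all finite $(\mathcal I,\mathrm{Act})$ and every non-absentminded one-player game structure $\mathcal T$ over $(\mathcal I,\mathrm{Act})$, the algorithm on input $\mathcal T$ halts and decides correctly whether $\mathcal T$ has S-ALR, and if $\mathcal T$ has S-ALR, it also outputs an S-ALR witness $\mathcal T'$ of $\mathcal T$. It makes at most $p(|A|)\cdot(|\mathcal T|+u(\mathcal T))$ steps, where $u(\mathcal T)$ is the number of chance nodes of $\mathcal T$ with exactly one child. In particular, for fixed $(\mathcal I,\mathrm{Act})$ it runs in time $O(|\mathcal T|)$ on all structures in which every chance node has at least two children. -/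

import Mathlib

/-! ### One-player game structures -/

/-- A one-player game structure over information sets `i : ι` with action sets `Act i`: a finite
rooted tree whose internal nodes are either nodes of the player, each lying in an information set
`i` and having exactly one outgoing edge for every action of `Act i`, or chance nodes with a finite
positive number `n + 1` of outgoing edges.  The information set `i` consists of all nodes
`player i _` of the tree; the action sets of different information sets are disjoint because an
action is an element of the disjoint union `Σ i, Act i`. -/
inductive GameStructure {ι : Type} (Act : ι → Type) : Type
  | leaf : GameStructure Act
  | player (i : ι) (child : Act i → GameStructure Act) : GameStructure Act
  | chance (n : ℕ) (child : Fin (n + 1) → GameStructure Act) : GameStructure Act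

namespace GameStructure

/-- The leaves of a game structure. -/
def Leaf {ι : Type} {Act : ι → Type} : GameStructure Act → Type
  | leaf => Unit
  | player i child => Σ a : Act i, (child a).Leaf
  | chance n child => Σ j : Fin (n + 1), (child j).Leaf

/-- The nodes of the player. -/
def PlayerNode {ι : Type} {Act : ι → Type} : GameStructure Act → Type
  | leaf => Empty
  | player i child => Unit ⊕ (Σ a : Act i, (child a).PlayerNode)
  | chance n child => Σ j : Fin (n + 1), (child j).PlayerNode

/-- The history of a leaf: the sequence of actions of the player on the path to it. -/
def leafHist {ι : Type} {Act : ι → Type} : (T : GameStructure Act) → T.Leaf → List (Σ i, Act i)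
  | leaf, _ => []
  | player i child, ⟨a, t⟩ => ⟨i, a⟩ :: (child a).leafHist t
  | chance _ child, ⟨j, t⟩ => (child j).leafHist t

/-- The history of a node of the player. -/
def nodeHist {ι : Type} {Act : ι → Type} :
    (T : GameStructure Act) → T.PlayerNode → List (Σ i, Act i)
  | leaf, _ => []
  | player _ _, Sum.inl _ => []
  | player i child, Sum.inr ⟨a, u⟩ => ⟨i, a⟩ :: (child a).nodeHist u
  | chance _ child, ⟨j, u⟩ => (child j).nodeHist u

/-- The information set in which a node of the player lies. -/
def infoSet {ι : Type} {Act : ι → Type} : (T : GameStructure Act) → T.PlayerNode → ι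
  | leaf, u => u.elim
  | player i _, Sum.inl _ => i
  | player _ child, Sum.inr ⟨a, u⟩ => (child a).infoSet u
  | chance _ child, ⟨j, u⟩ => (child j).infoSet u

/-- The size of a game structure: its number of leaves. -/
noncomputable def size {ι : Type} {Act : ι → Type} (T : GameStructure Act) : ℕ :=
  Nat.card T.Leaf

/-- `Nat.card` is the genuine number of leaves, as there are finitely many. -/
theorem finite_leaf {ι : Type} {Act : ι → Type} [∀ i, Finite (Act i)] :
    ∀ T : GameStructure Act, Finite T.Leaf
  | leaf => inferInstanceAs (Finite Unit)
  | player i child =>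
      have : ∀ a, Finite (child a).Leaf := fun a => finite_leaf (child a)
      inferInstanceAs (Finite (Σ a : Act i, (child a).Leaf))
  | chance n child =>
      have : ∀ j, Finite (child j).Leaf := fun j => finite_leaf (child j)
      inferInstanceAs (Finite (Σ j : Fin (n + 1), (child j).Leaf))

/-- The number of chance nodes with exactly one outgoing edge. -/
def numUnaryChance {ι : Type} {Act : ι → Type} [∀ i, Fintype (Act i)] : GameStructure Act → ℕ
  | leaf => 0
  | player _ child => ∑ a, (child a).numUnaryChance
  | chance n child => (if n = 0 then 1 else 0) + ∑ j, (child j).numUnaryChance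

/-- Non-absentmindedness: the nodes of the player on the path to any leaf lie in distinct
information sets. -/
def NonAbsentminded {ι : Type} {Act : ι → Type} (T : GameStructure Act) : Prop :=
  ∀ t : T.Leaf, ((T.leafHist t).map Sigma.fst).Nodup

/-- A-loss recall: two distinct nodes in one information set have equal histories, or their
histories branch with two different actions `a`, `b` of one information set `i`. -/
def ALossRecall {ι : Type} {Act : ι → Type} (T : GameStructure Act) : Prop :=
  ∀ u v : T.PlayerNode, u ≠ v → T.infoSet u = T.infoSet v →
    T.nodeHist u = T.nodeHist v ∨
      ∃ (s s₁ s₂ : List (Σ i, Act i)) (i : ι) (a b : Act i), a ≠ b ∧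
        T.nodeHist u = s ++ ⟨i, a⟩ :: s₁ ∧ T.nodeHist v = s ++ ⟨i, b⟩ :: s₂

/-- `T'` witnesses that `T` has shuffled A-loss recall. -/
def IsShuffledWitness {ι : Type} {Act : ι → Type} (T T' : GameStructure Act) : Prop :=
  T.size = T'.size ∧ T'.ALossRecall ∧
    ∃ f : T.Leaf ≃ T'.Leaf, ∀ t : T.Leaf, (T'.leafHist (f t)).Perm (T.leafHist t)

/-- Shuffled A-loss recall. -/
def HasShuffledALossRecall {ι : Type} {Act : ι → Type} (T : GameStructure Act) : Prop :=
  ∃ T' : GameStructure Act, T.IsShuffledWitness T'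

end GameStructure

/-! ### The machine model: first-order pure Lisp with a step count

Programs compute on binary trees (S-expressions); a program is a finite list of mutually recursive
unary functions.  Every evaluation of a subexpression costs one step.  Each such step takes a
constant number of instructions of a pointer machine or a random access machine (a cons cell is two
pointers), so a time bound in this model holds for those machines as well. -/

/-- S-expressions. -/
inductive LData : Type
  | nil : LData
  | cons (x y : LData) : LData

namespace LData

/-- First component (`nil` on `nil`). -/
def head : LData → LData
  | nil => nil
  | cons x _ => x

/-- Second component (`nil` on `nil`). -/
def tail : LData → LData
  | nil => nil
  | cons _ y => y

/-- The usual representation of lists. -/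
def ofList : List LData → LData
  | [] => nil
  | x :: l => cons x (ofList l)

/-- Unary numerals. -/
def ofNat : ℕ → LData
  | 0 => nil
  | n + 1 => cons nil (ofNat n)

end LData

/-- Expressions; variables are de Bruijn indices into the environment. -/
inductive LExpr : Type
  | var (k : ℕ) : LExpr
  | nil : LExpr
  | cons (e₁ e₂ : LExpr) : LExpr
  | head (e : LExpr) : LExpr
  | tail (e : LExpr) : LExpr
  | ifCons (c e₁ e₂ : LExpr) : LExpr
  | letIn (e₁ e₂ : LExpr) : LExpr
  | call (f : ℕ) (e : LExpr) : LExpr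

/-- A program: entry `f` is the body of the function `f`, in which `var 0` is the argument. -/
abbrev LProgram : Type := List LExpr

/-- `LEval P env e v n`: under the program `P` and in the environment `env`, the expression `e`
evaluates to `v` in exactly `n` steps (call by value).  If the evaluation diverges, or uses an
unbound variable or function, then there are no such `v` and `n`. -/
inductive LEval (P : LProgram) : List LData → LExpr → LData → ℕ → Prop
  | var {env : List LData} {k : ℕ} {v : LData} (h : env[k]? = some v) :
      LEval P env (LExpr.var k) v 1
  | nil {env : List LData} : LEval P env LExpr.nil LData.nil 1
  | cons {env : List LData} {e₁ e₂ : LExpr} {v₁ v₂ : LData} {n₁ n₂ : ℕ}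
      (h₁ : LEval P env e₁ v₁ n₁) (h₂ : LEval P env e₂ v₂ n₂) :
      LEval P env (LExpr.cons e₁ e₂) (LData.cons v₁ v₂) (n₁ + n₂ + 1)
  | head {env : List LData} {e : LExpr} {v : LData} {n : ℕ} (h : LEval P env e v n) :
      LEval P env (LExpr.head e) v.head (n + 1)
  | tail {env : List LData} {e : LExpr} {v : LData} {n : ℕ} (h : LEval P env e v n) :
      LEval P env (LExpr.tail e) v.tail (n + 1)
  | ifTrue {env : List LData} {c e₁ e₂ : LExpr} {x y v : LData} {n₁ n₂ : ℕ}
      (h₁ : LEval P env c (LData.cons x y) n₁) (h₂ : LEval P env e₁ v n₂) :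
      LEval P env (LExpr.ifCons c e₁ e₂) v (n₁ + n₂ + 1)
  | ifFalse {env : List LData} {c e₁ e₂ : LExpr} {v : LData} {n₁ n₂ : ℕ}
      (h₁ : LEval P env c LData.nil n₁) (h₂ : LEval P env e₂ v n₂) :
      LEval P env (LExpr.ifCons c e₁ e₂) v (n₁ + n₂ + 1)
  | letIn {env : List LData} {e₁ e₂ : LExpr} {v w : LData} {n₁ n₂ : ℕ}
      (h₁ : LEval P env e₁ v n₁) (h₂ : LEval P (v :: env) e₂ w n₂) :
      LEval P env (LExpr.letIn e₁ e₂) w (n₁ + n₂ + 1)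
  | call {env : List LData} {f : ℕ} {e body : LExpr} {v w : LData} {n₁ n₂ : ℕ}
      (hf : P[f]? = some body) (h₁ : LEval P env e v n₁) (h₂ : LEval P [v] body w n₂) :
      LEval P env (LExpr.call f e) w (n₁ + n₂ + 1)

/-- Evaluation is deterministic: value and number of steps are unique. -/
theorem LEval.deterministic {P : LProgram} {env : List LData} {e : LExpr} {v w : LData} {n m : ℕ}
    (h : LEval P env e v n) (h' : LEval P env e w m) : v = w ∧ n = m := by
  induction h generalizing w m with
  | var h => cases h' with | var g => exact ⟨Option.some.inj (h.symm.trans g), rfl⟩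
  | nil => cases h'; exact ⟨rfl, rfl⟩
  | cons _ _ ih₁ ih₂ =>
    cases h' with | cons g₁ g₂ =>
    obtain ⟨rfl, rfl⟩ := ih₁ g₁; obtain ⟨rfl, rfl⟩ := ih₂ g₂; exact ⟨rfl, rfl⟩
  | head _ ih => cases h' with | head g => obtain ⟨rfl, rfl⟩ := ih g; exact ⟨rfl, rfl⟩
  | tail _ ih => cases h' with | tail g => obtain ⟨rfl, rfl⟩ := ih g; exact ⟨rfl, rfl⟩
  | ifTrue _ _ ih₁ ih₂ =>
    cases h' with
    | ifTrue g₁ g₂ =>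
      obtain ⟨_, rfl⟩ := ih₁ g₁; obtain ⟨rfl, rfl⟩ := ih₂ g₂; exact ⟨rfl, rfl⟩
    | ifFalse g₁ g₂ => exact absurd (ih₁ g₁).1 (by simp)
  | ifFalse _ _ ih₁ ih₂ =>
    cases h' with
    | ifTrue g₁ g₂ => exact absurd (ih₁ g₁).1 (by simp)
    | ifFalse g₁ g₂ =>
      obtain ⟨_, rfl⟩ := ih₁ g₁; obtain ⟨rfl, rfl⟩ := ih₂ g₂; exact ⟨rfl, rfl⟩
  | letIn _ _ ih₁ ih₂ =>
    cases h' with | letIn g₁ g₂ =>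
    obtain ⟨rfl, rfl⟩ := ih₁ g₁; obtain ⟨rfl, rfl⟩ := ih₂ g₂; exact ⟨rfl, rfl⟩
  | call hf _ _ ih₁ ih₂ =>
    cases h' with | call gf g₁ g₂ =>
    obtain rfl := Option.some.inj (hf.symm.trans gf)
    obtain ⟨rfl, rfl⟩ := ih₁ g₁; obtain ⟨rfl, rfl⟩ := ih₂ g₂; exact ⟨rfl, rfl⟩

/-- The program `P`, started with its function `0` on the input `x`, halts with output `y` after
exactly `n` steps. -/
def LProgram.HaltsWith (P : LProgram) (x y : LData) (n : ℕ) : Prop :=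
  LEval P [x] (LExpr.call 0 (LExpr.var 0)) y n

/-- The S-expression of a game structure with information sets `0, …, m - 1` and `ar i` actions in
information set `i`: a leaf is `nil`, a node of information set `i` is the numeral `i + 1` followed
by the list of the children in the order of the actions, a chance node is the numeral `0` followed
by the list of its children. -/
def GameStructure.encode {m : ℕ} {ar : Fin m → ℕ} :
    GameStructure (fun i : Fin m => Fin (ar i)) → LData
  | .leaf => LData.nil
  | .player i child =>
      LData.cons (LData.ofNat (i.val + 1)) (LData.ofList (List.ofFn fun a => (child a).encode))
  | .chance _ child =>
      LData.cons (LData.ofNat 0) (LData.ofList (List.ofFn fun j => (child j).encode))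

set_option linter.unusedSectionVars false

/-! A witness is constrained only through the multiset of its leaf histories, each taken up to
order: `T'` witnesses `T` exactly when `T'` has A-loss recall and `T.bag = T'.bag`
(`isShuffledWitness_iff`). So the question is whether a given multiset `M` of histories is realized
by a forest with A-loss recall, the forest being thought of as hanging below a chance node.

Necessity. Discard chance nodes at the roots. A non-empty history `x` of `M` then lies in a tree
whose root is a player node, say of information set `j`. By A-loss recall every node of `j` lies in
a tree with root `j`, and no information set occurs both in such a tree and in a tree with another
root. Hence some `j` occurring in `x` is `Closed`: histories with `j` and histories without `j` have
no information set in common (`Realizes.exists_closed`).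

No backtracking. Let `j` be any closed information set that occurs in `M`. If `M` is realizable,
then so is the part without `j` (`Realizes.split`), and for each action `a` of `j` the part where
`a` is played, with `j` deleted, is non-empty and realizable (`Realizes.play`): fix the action `a`
at all nodes of `j`. Conversely, a root of `j` above realizations of these parts realizes `M`
(`realizes_cons_player`). Thus any closed `j` may be chosen greedily, and a non-empty history
without a closed entry proves that there is no witness. Empty histories become leaves.

Running time. In a non-absentminded structure a history has at most `m ≤ |A|` entries, so one level
of this recursion costs polynomially many steps in `|A|` per history. The parts into which `j`
splits `M` contain each history once (`sum_length_playList`) and no longer use `j`. Hence the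
recursion costs a polynomial in `|A|` times `|M| * (m + 1)` (`runs_forest`). Collecting the
histories is linear in the number of nodes (`gathers`), which is at most about `(|A| + 2) * (|T| +
u)` (`numNodes_add_one_le`). -/

namespace GameStructure

/-! ### Player nodes, branching histories and multisets of leaf histories -/

variable {ι : Type} {Act : ι → Type}

/-- Two histories branch with two different actions of one information set. -/
def Branch (s t : List (Σ i, Act i)) : Prop :=
  ∃ (p s₁ t₁ : List (Σ i, Act i)) (i : ι) (a b : Act i), a ≠ b ∧
    s = p ++ ⟨i, a⟩ :: s₁ ∧ t = p ++ ⟨i, b⟩ :: t₁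

/-- `T.HasNode k s`: some player node of `T` has information set `k` and history `s`. -/
def HasNode : GameStructure Act → ι → List (Σ i, Act i) → Prop
  | leaf, _, _ => False
  | player i child, k, s =>
      (k = i ∧ s = []) ∨ ∃ a t, s = ⟨i, a⟩ :: t ∧ (child a).HasNode k t
  | chance _ child, k, s => ∃ j, (child j).HasNode k s

theorem hasNode_iff (T : GameStructure Act) (k : ι) (s : List (Σ i, Act i)) :
    T.HasNode k s ↔ ∃ u : T.PlayerNode, T.infoSet u = k ∧ T.nodeHist u = s := by
  induction T generalizing s with
  | leaf =>
    constructor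
    · intro h; exact h.elim
    · rintro ⟨u, _⟩; exact u.elim
  | player i child ih =>
    constructor
    · rintro (⟨rfl, rfl⟩ | ⟨a, t, rfl, h⟩)
      · exact ⟨Sum.inl (), rfl, rfl⟩
      · obtain ⟨u, rfl, rfl⟩ := (ih a t).1 h
        exact ⟨Sum.inr ⟨a, u⟩, rfl, rfl⟩
    · rintro ⟨u | ⟨a, u⟩, rfl, rfl⟩
      · exact Or.inl ⟨rfl, rfl⟩
      · exact Or.inr ⟨a, _, rfl, (ih a _).2 ⟨u, rfl, rfl⟩⟩
  | chance n child ih =>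
    constructor
    · rintro ⟨j, h⟩
      obtain ⟨u, rfl, rfl⟩ := (ih j s).1 h
      exact ⟨⟨j, u⟩, rfl, rfl⟩
    · rintro ⟨⟨j, u⟩, rfl, rfl⟩
      exact ⟨j, (ih j _).2 ⟨u, rfl, rfl⟩⟩

/-- Only the pairs of information set and history matter. Distinctness of the two nodes can be
dropped because a node has the same history as itself. -/
theorem aLossRecall_iff (T : GameStructure Act) :
    T.ALossRecall ↔ ∀ k s t, T.HasNode k s → T.HasNode k t → s = t ∨ Branch s t := by
  constructor
  · intro h k s t hs ht
    obtain ⟨u, hu, rfl⟩ := (hasNode_iff T k s).1 hs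
    obtain ⟨v, hv, rfl⟩ := (hasNode_iff T k t).1 ht
    by_cases huv : u = v
    · exact Or.inl (by rw [huv])
    · exact h u v huv (hu.trans hv.symm)
  · intro h u v _ huv
    exact h _ _ _ ((hasNode_iff T _ _).2 ⟨u, huv, rfl⟩) ((hasNode_iff T _ _).2 ⟨v, rfl, rfl⟩)

/-- A-loss recall of the structure that consists of the trees of `F` below a chance node. -/
def ForestALR (F : List (GameStructure Act)) : Prop :=
  ∀ T ∈ F, ∀ T' ∈ F, ∀ k s t, T.HasNode k s → T'.HasNode k t → s = t ∨ Branch s t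

variable [∀ i, Fintype (Act i)]

/-- The multiset of the leaf histories, each up to permutation. -/
def bag : GameStructure Act → Multiset (Multiset (Σ i, Act i))
  | leaf => {0}
  | player i child => ∑ a, (child a).bag.map (fun x => ⟨i, a⟩ ::ₘ x)
  | chance _ child => ∑ j, (child j).bag

/-- The forest `F` has A-loss recall and its leaf histories are those in `M`. -/
def Realizes (F : List (GameStructure Act)) (M : Multiset (Multiset (Σ i, Act i))) : Prop :=
  ForestALR F ∧ (F.map bag).sum = M

/-- The information sets of a history. -/
def infos (x : Multiset (Σ i, Act i)) : Multiset ι := x.map Sigma.fst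

theorem mem_infos {x : Multiset (Σ i, Act i)} {k : ι} : k ∈ infos x ↔ ∃ a, (⟨k, a⟩ : Σ i, Act i) ∈ x := by
  simp only [infos, Multiset.mem_map]
  constructor
  · rintro ⟨⟨i, a⟩, h, rfl⟩; exact ⟨a, h⟩
  · rintro ⟨a, h⟩; exact ⟨_, h, rfl⟩

theorem mem_bag_player {i : ι} {child : Act i → GameStructure Act} {x} :
    x ∈ (player i child).bag ↔ ∃ a, ∃ y ∈ (child a).bag, ⟨i, a⟩ ::ₘ y = x := by
  simp [bag, Multiset.mem_sum]

theorem mem_bag_chance {n : ℕ} {child : Fin (n + 1) → GameStructure Act} {x} :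
    x ∈ (chance n child).bag ↔ ∃ j, x ∈ (child j).bag := by
  simp [bag, Multiset.mem_sum]

theorem mem_sum_bag {F : List (GameStructure Act)} {x} :
    x ∈ (F.map bag).sum ↔ ∃ T ∈ F, x ∈ T.bag := by
  induction F with
  | nil => simp
  | cons T F ih => simp [ih]

theorem Realizes.mem {F : List (GameStructure Act)} {M} (h : Realizes F M) {x} :
    x ∈ M ↔ ∃ T ∈ F, x ∈ T.bag := by
  rw [← h.2, mem_sum_bag]

theorem exists_mem_bag [∀ i, Nonempty (Act i)] (T : GameStructure Act) : ∃ x, x ∈ T.bag := by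
  induction T with
  | leaf => exact ⟨0, by simp [bag]⟩
  | player i child ih =>
    obtain ⟨a⟩ := (inferInstance : Nonempty (Act i))
    obtain ⟨x, hx⟩ := ih a
    exact ⟨_, mem_bag_player.2 ⟨a, x, hx, rfl⟩⟩
  | chance n child ih =>
    obtain ⟨x, hx⟩ := ih 0
    exact ⟨x, mem_bag_chance.2 ⟨0, hx⟩⟩

/-- Non-empty action sets guarantee a leaf below every player node. With `exists_hasNode` this
allows passing between nodes and leaf histories. -/
theorem HasNode.exists_mem_bag [∀ i, Nonempty (Act i)] {T : GameStructure Act} {k s}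
    (h : T.HasNode k s) : ∃ x ∈ T.bag, k ∈ infos x := by
  induction T generalizing s with
  | leaf => exact h.elim
  | player i child ih =>
    rcases h with ⟨rfl, rfl⟩ | ⟨a, t, rfl, h⟩
    · obtain ⟨x, hx⟩ := GameStructure.exists_mem_bag (player k child)
      refine ⟨x, hx, ?_⟩
      obtain ⟨a, y, _, rfl⟩ := mem_bag_player.1 hx
      simp [infos]
    · obtain ⟨x, hx, hk⟩ := ih a h
      refine ⟨_, mem_bag_player.2 ⟨a, x, hx, rfl⟩, ?_⟩
      simp only [infos, Multiset.map_cons, Multiset.mem_cons]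
      exact Or.inr hk
  | chance n child ih =>
    obtain ⟨j, h⟩ := h
    obtain ⟨x, hx, hk⟩ := ih j h
    exact ⟨x, mem_bag_chance.2 ⟨j, hx⟩, hk⟩

theorem exists_hasNode {T : GameStructure Act} {k x} (hx : x ∈ T.bag) (hk : k ∈ infos x) :
    ∃ s, T.HasNode k s := by
  induction T generalizing x with
  | leaf => simp [bag] at hx; subst hx; simp [infos] at hk
  | player i child ih =>
    obtain ⟨a, y, hy, rfl⟩ := mem_bag_player.1 hx
    simp only [infos, Multiset.map_cons, Multiset.mem_cons] at hk
    rcases hk with rfl | hk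
    · exact ⟨[], Or.inl ⟨rfl, rfl⟩⟩
    · obtain ⟨s, hs⟩ := ih a hy hk
      exact ⟨_, Or.inr ⟨a, s, rfl, hs⟩⟩
  | chance n child ih =>
    obtain ⟨j, hj⟩ := mem_bag_chance.1 hx
    obtain ⟨s, hs⟩ := ih j hj hk
    exact ⟨s, j, hs⟩

theorem HasNode.player_head {i : ι} {child : Act i → GameStructure Act} {k s}
    (h : (player i child).HasNode k s) : (k = i ∧ s = []) ∨ ∃ a t, s = ⟨i, a⟩ :: t := by
  rcases h with h | ⟨a, t, h, _⟩
  · exact Or.inl h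
  · exact Or.inr ⟨a, t, h⟩

theorem not_branch_nil_left {t : List (Σ i, Act i)} : ¬ Branch [] t := by
  rintro ⟨p, s₁, t₁, i, a, b, _, h, _⟩
  simp at h

theorem not_branch_nil_right {t : List (Σ i, Act i)} : ¬ Branch t [] := by
  rintro ⟨p, s₁, t₁, i, a, b, _, _, h⟩
  simp at h

/-- The branching happens either at the first entries, which then share their information set, or
later, and then the first entries are equal. -/
theorem Branch.head {e e' : Σ i, Act i} {s t} (h : Branch (e :: s) (e' :: t)) : e.1 = e'.1 := by
  obtain ⟨p, s₁, t₁, i, a, b, _, h, h'⟩ := h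
  cases p with
  | nil => simp only [List.nil_append, List.cons.injEq] at h h'; rw [h.1, h'.1]
  | cons q p => simp only [List.cons_append, List.cons.injEq] at h h'; rw [h.1, h'.1]

theorem Branch.cons {s t : List (Σ i, Act i)} (h : Branch s t) (e : Σ i, Act i) :
    Branch (e :: s) (e :: t) := by
  obtain ⟨p, s₁, t₁, i, a, b, hab, rfl, rfl⟩ := h
  exact ⟨e :: p, s₁, t₁, i, a, b, hab, rfl, rfl⟩

/-! ### Removing the chance nodes at the root -/

/-- The maximal subtrees that are not rooted at chance nodes. -/
def tops : GameStructure Act → List (GameStructure Act)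
  | leaf => [leaf]
  | player i child => [player i child]
  | chance _ child => (List.ofFn fun j => (child j).tops).flatten

theorem sum_map_bag_flatten (L : List (List (GameStructure Act))) :
    (L.flatten.map bag).sum = (L.map fun F => (F.map bag).sum).sum := by
  induction L with
  | nil => rfl
  | cons F L ih => rw [List.flatten_cons, List.map_append, List.sum_append, ih, List.map_cons, List.sum_cons]

theorem sum_bag_tops (T : GameStructure Act) : (T.tops.map bag).sum = T.bag := by
  induction T with
  | leaf => simp [tops]
  | player i child ih => simp [tops]
  | chance n child ih =>
    rw [tops, sum_map_bag_flatten, List.map_ofFn, List.sum_ofFn, bag]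
    exact Finset.sum_congr rfl fun j _ => ih j

theorem hasNode_of_mem_tops {T T' : GameStructure Act} (h : T' ∈ T.tops) {k s}
    (hs : T'.HasNode k s) : T.HasNode k s := by
  induction T with
  | leaf => simp only [tops, List.mem_singleton] at h; rwa [← h]
  | player i child ih => simp only [tops, List.mem_singleton] at h; rwa [← h]
  | chance n child ih =>
    simp only [tops, List.mem_flatten, List.mem_ofFn] at h
    obtain ⟨_, ⟨j, rfl⟩, h⟩ := h
    exact ⟨j, ih j h⟩

theorem leaf_or_player_of_mem_tops {T T' : GameStructure Act} (h : T' ∈ T.tops) :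
    T' = leaf ∨ ∃ i child, T' = player i child := by
  induction T with
  | leaf => simp only [tops, List.mem_singleton] at h; exact Or.inl h
  | player i child ih =>
    simp only [tops, List.mem_singleton] at h; exact Or.inr ⟨i, child, h⟩
  | chance n child ih =>
    simp only [tops, List.mem_flatten, List.mem_ofFn] at h
    obtain ⟨_, ⟨j, rfl⟩, h⟩ := h
    exact ih j h

/-- Chance moves leave no trace in histories, so each tree may be replaced by its `tops`; the root
of each tree then shows in all its leaf histories. -/
theorem Realizes.exists_flat {F : List (GameStructure Act)} {M} (h : Realizes F M) :
    ∃ G, Realizes G M ∧ ∀ T ∈ G, T = leaf ∨ ∃ i child, T = player i child := by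
  refine ⟨(F.map tops).flatten, ⟨?_, ?_⟩, ?_⟩
  · intro T hT T' hT' k s t hs ht
    simp only [List.mem_flatten, List.mem_map] at hT hT'
    obtain ⟨_, ⟨U, hU, rfl⟩, hT⟩ := hT
    obtain ⟨_, ⟨U', hU', rfl⟩, hT'⟩ := hT'
    exact h.1 U hU U' hU' k s t (hasNode_of_mem_tops hT hs) (hasNode_of_mem_tops hT' ht)
  · rw [sum_map_bag_flatten, List.map_map, ← h.2]
    congr 1
    exact List.map_congr_left fun T _ => sum_bag_tops T
  · intro T hT
    simp only [List.mem_flatten, List.mem_map] at hT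
    obtain ⟨_, ⟨U, hU, rfl⟩, hT⟩ := hT
    exact leaf_or_player_of_mem_tops hT

/-- In a flat forest an empty history can only come from a tree that is a single leaf, since a
player root contributes an entry to every history below it. -/
theorem Realizes.remove_leaf {F : List (GameStructure Act)} {M} (h : Realizes F (0 ::ₘ M)) :
    ∃ G, Realizes G M := by
  obtain ⟨G, hG, hflat⟩ := h.exists_flat
  obtain ⟨T, hT, h0⟩ := hG.mem.1 (Multiset.mem_cons_self 0 M)
  have hleaf : T = leaf := by
    rcases hflat T hT with h | ⟨i, child, rfl⟩
    · exact h
    · obtain ⟨a, y, _, h⟩ := mem_bag_player.1 h0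
      exact absurd h (Multiset.cons_ne_zero)
  subst hleaf
  obtain ⟨l₁, l₂, rfl⟩ := List.append_of_mem hT
  refine ⟨l₁ ++ l₂, ?_, ?_⟩
  · intro T hT T' hT'
    apply hG.1
    · simp only [List.mem_append, List.mem_cons] at hT ⊢; tauto
    · simp only [List.mem_append, List.mem_cons] at hT' ⊢; tauto
  · have := hG.2
    simp only [List.map_append, List.map_cons, List.sum_append, List.sum_cons, bag] at this ⊢
    rw [← Multiset.singleton_add] at this
    rw [add_left_comm] at this
    exact add_left_cancel this

theorem Realizes.add_leaf {F : List (GameStructure Act)} {M} (h : Realizes F M) :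
    Realizes (leaf :: F) (0 ::ₘ M) := by
  refine ⟨?_, ?_⟩
  · intro T hT T' hT' k s t hs ht
    rcases List.mem_cons.1 hT with rfl | hT
    · exact hs.elim
    rcases List.mem_cons.1 hT' with rfl | hT'
    · exact ht.elim
    exact h.1 T hT T' hT' k s t hs ht
  · simp [h.2, bag]

/-! ### Information sets that can be moved to the root -/

/-- The histories that contain `j` share no information set with those that do not. -/
def Closed (j : ι) (M : Multiset (Multiset (Σ i, Act i))) : Prop :=
  ∀ x ∈ M, ∀ y ∈ M, j ∈ infos x → j ∉ infos y → ∀ i ∈ infos x, i ∉ infos y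

/-- The witness is the root of the tree that contains `x`. A shared information set `i` would have
nodes in trees with different roots, whose histories are neither equal nor branching. -/
theorem Realizes.exists_closed {F : List (GameStructure Act)} {M} (h : Realizes F M) {x}
    (hx : x ∈ M) (hx0 : x ≠ 0) : ∃ e ∈ x, Closed e.1 M := by
  obtain ⟨G, hG, hflat⟩ := h.exists_flat
  obtain ⟨T, hT, hxT⟩ := hG.mem.1 hx
  rcases hflat T hT with rfl | ⟨j, child, rfl⟩
  · simp [bag] at hxT; exact absurd hxT hx0
  obtain ⟨a, y, hy, rfl⟩ := mem_bag_player.1 hxT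
  refine ⟨⟨j, a⟩, Multiset.mem_cons_self _ _, ?_⟩
  intro x₁ hx₁ x₂ hx₂ hj₁ hj₂ i hi₁ hi₂
  obtain ⟨T₁, hT₁, hxT₁⟩ := hG.mem.1 hx₁
  obtain ⟨T₂, hT₂, hxT₂⟩ := hG.mem.1 hx₂
  rcases hflat T₂ hT₂ with rfl | ⟨r₂, c₂, rfl⟩
  · simp [bag] at hxT₂; subst hxT₂; simp [infos] at hi₂
  have hr₂ : r₂ ≠ j := by
    rintro rfl
    obtain ⟨a, y, _, rfl⟩ := mem_bag_player.1 hxT₂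
    simp [infos] at hj₂
  rcases hflat T₁ hT₁ with rfl | ⟨r₁, c₁, rfl⟩
  · simp [bag] at hxT₁; subst hxT₁; simp [infos] at hi₁
  -- The root of `T` is a node of `j` with empty history, which branches with nothing; so every node
  -- of `j` is a root.
  have hr₁ : r₁ = j := by
    obtain ⟨s, hs⟩ := exists_hasNode hxT₁ hj₁
    have := hG.1 _ hT _ hT₁ j [] s (Or.inl ⟨rfl, rfl⟩) hs
    rcases this with rfl | h
    · rcases hs.player_head with h | ⟨_, _, h⟩
      · exact h.1.symm
      · simp at h
    · exact absurd h not_branch_nil_left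
  -- Nodes of `i` in both trees: their histories are empty or start with entries of `j` and of `r₂ ≠
  -- j`. All four combinations are contradictory.
  obtain ⟨s₁, hs₁⟩ := exists_hasNode hxT₁ hi₁
  obtain ⟨s₂, hs₂⟩ := exists_hasNode hxT₂ hi₂
  have := hG.1 _ hT₁ _ hT₂ i s₁ s₂ hs₁ hs₂
  rcases hs₁.player_head with ⟨h₁, rfl⟩ | ⟨a₁, t₁, rfl⟩ <;>
    rcases hs₂.player_head with ⟨h₂, rfl⟩ | ⟨a₂, t₂, rfl⟩
  · exact hr₂ (h₂.symm.trans (h₁.trans hr₁))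
  · rcases this with h | h
    · simp at h
    · exact not_branch_nil_left h
  · rcases this with h | h
    · simp at h
    · exact not_branch_nil_right h
  · rcases this with h | h
    · rw [List.cons.injEq, Sigma.mk.injEq] at h
      exact hr₂ (h.1.1.symm.trans hr₁)
    · exact hr₂ (h.head.symm.trans hr₁)

theorem sum_map_bag_filter (G : List (GameStructure Act)) (q : GameStructure Act → Bool)
    (p : Multiset (Σ i, Act i) → Prop) [DecidablePred p]
    (h : ∀ T ∈ G, (q T = true → ∀ x ∈ T.bag, p x) ∧ (q T = false → ∀ x ∈ T.bag, ¬ p x)) :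
    ((G.filter q).map bag).sum = (G.map bag).sum.filter p := by
  induction G with
  | nil => simp
  | cons T G ih =>
    have ih := ih fun T hT => h T (List.mem_cons_of_mem _ hT)
    have hT := h T List.mem_cons_self
    simp only [List.map_cons, List.sum_cons, Multiset.filter_add]
    cases hq : q T with
    | true =>
      rw [List.filter_cons_of_pos hq, List.map_cons, List.sum_cons, ih,
        Multiset.filter_eq_self.2 (hT.1 hq)]
    | false =>
      rw [List.filter_cons_of_neg (by simp [hq]), ih, Multiset.filter_eq_nil.2 (hT.2 hq), zero_add]

theorem Realizes.filter {G : List (GameStructure Act)} {M} (hG : Realizes G M)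
    (q : GameStructure Act → Bool) (p : Multiset (Σ i, Act i) → Prop) [DecidablePred p]
    (h : ∀ T ∈ G, (q T = true → ∀ x ∈ T.bag, p x) ∧ (q T = false → ∀ x ∈ T.bag, ¬ p x)) :
    Realizes (G.filter q) (M.filter p) :=
  ⟨fun T hT T' hT' => hG.1 T (List.mem_filter.1 hT).1 T' (List.mem_filter.1 hT').1, by
    rw [sum_map_bag_filter G q p h, hG.2]⟩

variable [DecidableEq ι]

/-- In a flat forest no tree mixes the two kinds of histories: its root would be an information set
common to both, against closedness. So it suffices to sort whole trees. -/
theorem Realizes.split {F : List (GameStructure Act)} {M} (h : Realizes F M) {j : ι}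
    (hj : Closed j M) :
    (∃ G, Realizes G (M.filter fun x => j ∈ infos x)) ∧
      ∃ G, Realizes G (M.filter fun x => j ∉ infos x) := by
  classical
  obtain ⟨G, hG, hflat⟩ := h.exists_flat
  have key : ∀ T ∈ G, ∀ x ∈ T.bag, ∀ y ∈ T.bag, j ∈ infos x → j ∈ infos y := by
    intro T hT x hx y hy hjx
    by_contra hjy
    rcases hflat T hT with rfl | ⟨r, c, rfl⟩
    · simp [bag] at hx; subst hx; simp [infos] at hjx
    refine hj x (hG.mem.2 ⟨_, hT, hx⟩) y (hG.mem.2 ⟨_, hT, hy⟩) hjx hjy r ?_ ?_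
    · obtain ⟨a, z, _, rfl⟩ := mem_bag_player.1 hx; simp [infos]
    · obtain ⟨a, z, _, rfl⟩ := mem_bag_player.1 hy; simp [infos]
  refine ⟨⟨_, hG.filter (fun T => decide (∃ x ∈ T.bag, j ∈ infos x)) _ ?_⟩,
    ⟨_, hG.filter (fun T => decide (¬ ∃ x ∈ T.bag, j ∈ infos x)) _ ?_⟩⟩
  · intro T hT
    simp only [decide_eq_true_eq, decide_eq_false_iff_not]
    exact ⟨fun ⟨x, hx, hjx⟩ y hy => key T hT x hx y hy hjx, fun h y hy hjy => h ⟨y, hy, hjy⟩⟩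
  · intro T hT
    simp only [decide_eq_true_eq, decide_eq_false_iff_not, not_not]
    exact ⟨fun h y hy hjy => h ⟨y, hy, hjy⟩, fun ⟨x, hx, hjx⟩ y hy => key T hT x hx y hy hjx⟩

/-! ### Fixing the action in one information set -/

variable [∀ i, DecidableEq (Act i)]

/-- The structure that results when the action `a` is played in the information set `j`. -/
def cond (j : ι) (a : Act j) : GameStructure Act → GameStructure Act
  | leaf => leaf
  | player i child =>
      if h : i = j then (child (h ▸ a)).cond j a else player i fun b => (child b).cond j a
  | chance n child => chance n fun k => (child k).cond j a

/-- The history contains no action of `j` other than `a`. -/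
def Compat (j : ι) (a : Act j) (x : Multiset (Σ i, Act i)) : Prop :=
  ∀ e ∈ x, e.1 = j → e = ⟨j, a⟩

instance (j : ι) (a : Act j) : DecidablePred (Compat j a) := fun x =>
  inferInstanceAs (Decidable (∀ e ∈ x, e.1 = j → e = ⟨j, a⟩))

/-- Deletion of the information set `j` from a history. -/
def del (j : ι) (x : Multiset (Σ i, Act i)) : Multiset (Σ i, Act i) :=
  x.filter fun e => e.1 ≠ j

theorem filter_sum' {β γ : Type} (s : Finset β) (f : β → Multiset γ) (p : γ → Prop)
    [DecidablePred p] : (∑ b ∈ s, f b).filter p = ∑ b ∈ s, (f b).filter p := by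
  classical
  induction s using Finset.induction_on with
  | empty => simp
  | insert b s hb ih => rw [Finset.sum_insert hb, Finset.sum_insert hb, Multiset.filter_add, ih]

theorem map_sum' {β γ δ : Type} (s : Finset β) (f : β → Multiset γ) (p : γ → δ) :
    (∑ b ∈ s, f b).map p = ∑ b ∈ s, (f b).map p :=
  map_sum (Multiset.mapAddMonoidHom p) f s

/-- `Compat` also admits histories that avoid `j` or repeat it with the same action, so the identity
needs no non-absentmindedness. -/
theorem bag_cond (j : ι) (a : Act j) (T : GameStructure Act) :
    (T.cond j a).bag = (T.bag.filter (Compat j a)).map (del j) := by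
  induction T with
  | leaf =>
    have : Compat j a 0 := fun e he => absurd he (Multiset.notMem_zero e)
    simp [cond, bag, Multiset.filter_singleton, this, del]
  | player i child ih =>
    rw [cond, bag, filter_sum', map_sum']
    split_ifs with h
    · subst h
      rw [Finset.sum_eq_single a]
      · rw [ih, Multiset.filter_map, Multiset.map_map]
        have : (Compat i a ∘ fun x => ⟨i, a⟩ ::ₘ x) = Compat i a := by
          funext x; simp [Compat]
        simp only [this]
        refine Multiset.map_congr rfl fun x _ => ?_
        simp [del]
      · intro b _ hb
        rw [Multiset.filter_eq_nil.2, Multiset.map_zero]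
        intro x hx hc
        obtain ⟨y, _, rfl⟩ := Multiset.mem_map.1 hx
        have := hc ⟨i, b⟩ (Multiset.mem_cons_self _ _) rfl
        simp only [Sigma.mk.injEq, heq_eq_eq, true_and] at this
        exact hb this
      · simp
    · rw [bag]
      refine Finset.sum_congr rfl fun b _ => ?_
      rw [ih, Multiset.filter_map, Multiset.map_map, Multiset.map_map]
      have : (Compat j a ∘ fun x => ⟨i, b⟩ ::ₘ x) = Compat j a := by
        funext x; simp [Compat, h]
      simp only [this]
      refine Multiset.map_congr rfl fun x _ => ?_
      simp [del, h]
  | chance n child ih =>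
    rw [cond, bag, bag, filter_sum', map_sum']
    exact Finset.sum_congr rfl fun k _ => ih k

theorem HasNode.of_cond {j : ι} {a : Act j} {T : GameStructure Act} {k s'}
    (h : (T.cond j a).HasNode k s') :
    ∃ s, T.HasNode k s ∧ s' = s.filter (fun e => e.1 ≠ j) ∧ Compat j a s := by
  induction T generalizing s' with
  | leaf => exact h.elim
  | player i child ih =>
    rw [cond] at h
    split_ifs at h with hi
    · subst hi
      obtain ⟨s, hs, rfl, hc⟩ := ih _ h
      refine ⟨_, Or.inr ⟨a, s, rfl, hs⟩, by simp, ?_⟩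
      simpa [Compat] using hc
    · rcases h with ⟨rfl, rfl⟩ | ⟨b, t, rfl, h⟩
      · exact ⟨[], Or.inl ⟨rfl, rfl⟩, rfl, by simp [Compat]⟩
      · obtain ⟨s, hs, rfl, hc⟩ := ih _ h
        refine ⟨_, Or.inr ⟨b, s, rfl, hs⟩, by simp [hi], ?_⟩
        simpa [Compat, hi] using hc
  | chance n child ih =>
    obtain ⟨l, h⟩ := h
    obtain ⟨s, hs, h'⟩ := ih l h
    exact ⟨s, ⟨l, hs⟩, h'⟩

/-- Two surviving histories contain no action of `j` other than `a`, so they cannot branch at `j`;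
their branching entries survive the deletion of `j`. -/
theorem ForestALR.cond {F : List (GameStructure Act)} (h : ForestALR F) (j : ι) (a : Act j) :
    ForestALR (F.map (cond j a)) := by
  intro T hT T' hT' k s' t' hs' ht'
  obtain ⟨U, hU, rfl⟩ := List.mem_map.1 hT
  obtain ⟨U', hU', rfl⟩ := List.mem_map.1 hT'
  obtain ⟨s, hs, rfl, hsc⟩ := hs'.of_cond
  obtain ⟨t, ht, rfl, htc⟩ := ht'.of_cond
  rcases h U hU U' hU' k s t hs ht with rfl | ⟨p, s₁, t₁, i, b, c, hbc, rfl, rfl⟩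
  · exact Or.inl rfl
  · right
    have hij : i ≠ j := by
      rintro rfl
      have h₁ := hsc ⟨i, b⟩ (by simp) rfl
      have h₂ := htc ⟨i, c⟩ (by simp) rfl
      exact hbc (by simpa using h₁.trans h₂.symm)
    refine ⟨p.filter (fun e => e.1 ≠ j), s₁.filter (fun e => e.1 ≠ j),
      t₁.filter (fun e => e.1 ≠ j), i, b, c, hbc, ?_, ?_⟩
    · rw [List.filter_append, List.filter_cons_of_pos (by simp [hij])]
    · rw [List.filter_append, List.filter_cons_of_pos (by simp [hij])]

/-- The histories of `M` in which the action `a` is played in `j`, without this action. -/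
def play (j : ι) (a : Act j) (M : Multiset (Multiset (Σ i, Act i))) :
    Multiset (Multiset (Σ i, Act i)) :=
  (M.filter fun x => (⟨j, a⟩ : Σ i, Act i) ∈ x).map (del j)

theorem compat_iff {j : ι} {a : Act j} {x : Multiset (Σ i, Act i)} (hx : (infos x).Nodup)
    (hj : j ∈ infos x) : Compat j a x ↔ (⟨j, a⟩ : Σ i, Act i) ∈ x := by
  obtain ⟨b, hb⟩ := mem_infos.1 hj
  constructor
  · intro h
    rw [← h _ hb rfl]; exact hb
  · intro ha e he hej
    exact Multiset.inj_on_of_nodup_map hx e he _ ha hej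

/-- Condition on `a` in the trees that contain `j`. For histories that contain `j` exactly once,
compatibility with `a` means containing `a`. -/
theorem Realizes.play [∀ i, Nonempty (Act i)] {F : List (GameStructure Act)} {M}
    (h : Realizes F M) {j : ι} (hj : Closed j M) (hnd : ∀ x ∈ M, (infos x).Nodup)
    (hex : ∃ x ∈ M, j ∈ infos x) (a : Act j) :
    play j a M ≠ 0 ∧ ∃ G, Realizes G (play j a M) := by
  obtain ⟨G, hG⟩ := (h.split hj).1
  have hb : ((G.map (GameStructure.cond j a)).map bag).sum = GameStructure.play j a M := by
    have : ∀ G : List (GameStructure Act), ((G.map (GameStructure.cond j a)).map bag).sum =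
        ((G.map bag).sum.filter (Compat j a)).map (del j) := by
      intro G
      induction G with
      | nil => simp
      | cons T G ih =>
        simp only [List.map_cons, List.sum_cons, Multiset.filter_add, Multiset.map_add, bag_cond]
        rw [← ih]
    rw [this, hG.2, GameStructure.play, Multiset.filter_filter]
    congr 1
    refine Multiset.filter_congr fun x hx => ?_
    constructor
    · rintro ⟨h₁, h₂⟩; exact (compat_iff (hnd x hx) h₂).1 h₁
    · intro h
      have h₂ : j ∈ infos x := mem_infos.2 ⟨a, h⟩
      exact ⟨(compat_iff (hnd x hx) h₂).2 h, h₂⟩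
  refine ⟨?_, _, hG.1.cond j a, hb⟩
  -- Some tree contains `j`; after conditioning it still has a leaf, so the part for `a` cannot be
  -- empty.
  obtain ⟨x, hx, hjx⟩ := hex
  obtain ⟨T, hT, _⟩ := hG.mem.1 (Multiset.mem_filter.2 ⟨hx, hjx⟩)
  obtain ⟨y, hy⟩ := GameStructure.exists_mem_bag (T.cond j a)
  intro h0
  rw [← hb] at h0
  have : y ∈ ((G.map (GameStructure.cond j a)).map bag).sum :=
    mem_sum_bag.2 ⟨_, List.mem_map_of_mem hT, hy⟩
  rw [h0] at this
  exact Multiset.notMem_zero _ this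

/-- A history with `j` contains exactly one action of `j`, hence occurs in exactly one summand,
where putting the action back undoes the deletion. -/
theorem sum_play_add (j : ι) (M : Multiset (Multiset (Σ i, Act i)))
    (hnd : ∀ x ∈ M, (infos x).Nodup) :
    ∑ a, (play j a M).map (fun x => ⟨j, a⟩ ::ₘ x) + M.filter (fun x => j ∉ infos x) = M := by
  induction M using Multiset.induction_on with
  | empty => simp [play]
  | cons x M ih =>
    have ih := ih fun y hy => hnd y (Multiset.mem_cons_of_mem hy)
    have hx := hnd x (Multiset.mem_cons_self _ _)
    have hplay : ∀ a : Act j, play j a (x ::ₘ M) =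
        (if (⟨j, a⟩ : Σ i, Act i) ∈ x then {del j x} else 0) + play j a M := by
      intro a
      simp only [play, Multiset.filter_cons, Multiset.map_add]
      split_ifs <;> simp
    simp only [hplay, Multiset.map_add, Finset.sum_add_distrib, Multiset.filter_cons]
    conv_rhs => rw [← ih, ← Multiset.singleton_add]
    by_cases hj : j ∈ infos x
    · obtain ⟨a, ha⟩ := mem_infos.1 hj
      have hc := (compat_iff hx hj).2 ha
      rw [Finset.sum_eq_single a]
      · have : (⟨j, a⟩ : Σ i, Act i) ::ₘ del j x = x := by
          -- The entries removed by `del` are exactly one copy of `⟨j, a⟩`.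
          have h1 : x.filter (fun e => ¬ e.1 ≠ j) = {⟨j, a⟩} := by
            have : x.filter (fun e => ¬ e.1 ≠ j) = x.filter (fun e => e = ⟨j, a⟩) := by
              refine Multiset.filter_congr fun e he => ?_
              simp only [ne_eq, not_not]
              exact ⟨hc e he, fun h => by rw [h]⟩
            rw [this, Multiset.filter_eq', Multiset.count_eq_one_of_mem (Multiset.Nodup.of_map _ hx) ha]
            rfl
          rw [← Multiset.singleton_add, ← h1, del, add_comm, Multiset.filter_add_not]
        simp [ha, this, hj]
      · intro b _ hb
        have : (⟨j, b⟩ : Σ i, Act i) ∉ x := fun h => hb (by simpa using hc _ h rfl)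
        simp [this]
      · simp
    · have : ∀ a : Act j, (⟨j, a⟩ : Σ i, Act i) ∉ x := fun a ha => hj (mem_infos.2 ⟨a, ha⟩)
      simp [this, hj]

/-! ### Assembling a realization from realizations of its parts -/

/-- A chance node above the trees of a nonempty forest. -/
def ofForest (F : List (GameStructure Act)) (h : F ≠ []) : GameStructure Act :=
  chance (F.length - 1) fun k =>
    F[k.val]'(by have := List.length_pos_of_ne_nil h; omega)

theorem mem_iff_exists_child (F : List (GameStructure Act)) (h : F ≠ []) (T : GameStructure Act) :
    T ∈ F ↔ ∃ k : Fin (F.length - 1 + 1),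
      F[k.val]'(by have := List.length_pos_of_ne_nil h; omega) = T := by
  rw [List.mem_iff_getElem]
  have := List.length_pos_of_ne_nil h
  constructor
  · rintro ⟨k, hk, rfl⟩; exact ⟨⟨k, by omega⟩, rfl⟩
  · rintro ⟨k, rfl⟩; exact ⟨k, by omega, rfl⟩

theorem hasNode_ofForest {F : List (GameStructure Act)} {h : F ≠ []} {k s} :
    (ofForest F h).HasNode k s ↔ ∃ T ∈ F, T.HasNode k s := by
  constructor
  · rintro ⟨l, hl⟩
    exact ⟨_, (mem_iff_exists_child F h _).2 ⟨l, rfl⟩, hl⟩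
  · rintro ⟨T, hT, hs⟩
    obtain ⟨l, rfl⟩ := (mem_iff_exists_child F h T).1 hT
    exact ⟨l, hs⟩

theorem ofFn_forest (F : List (GameStructure Act)) (h : F ≠ []) :
    (List.ofFn fun k : Fin (F.length - 1 + 1) =>
      F[k.val]'(by have := List.length_pos_of_ne_nil h; omega)) = F := by
  have := List.length_pos_of_ne_nil h
  apply List.ext_getElem
  · simp; omega
  · intro i h₁ h₂; rw [List.getElem_ofFn]

theorem bag_ofForest {F : List (GameStructure Act)} {h : F ≠ []} :
    (ofForest F h).bag = (F.map bag).sum := by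
  rw [ofForest, bag, ← List.sum_ofFn]
  conv_rhs => rw [← ofFn_forest F h, List.map_ofFn]
  rfl

theorem mem_infos_del {j k : ι} {x : Multiset (Σ i, Act i)} :
    k ∈ infos (del j x) ↔ k ∈ infos x ∧ k ≠ j := by
  simp [mem_infos, del]

/-- By closedness the new tree shares no information set with `FN`, so no comparison across the two
is needed. Inside the new tree, nodes below different actions branch at the root, and nodes below
the same action inherit the property from `FA a`. -/
theorem realizes_cons_player [∀ i, Nonempty (Act i)] {M : Multiset (Multiset (Σ i, Act i))} {j : ι}
    (hj : Closed j M) (hnd : ∀ x ∈ M, (infos x).Nodup) {FN : List (GameStructure Act)}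
    (hN : Realizes FN (M.filter fun x => j ∉ infos x))
    {FA : Act j → List (GameStructure Act)} (hne : ∀ a, FA a ≠ [])
    (hA : ∀ a, Realizes (FA a) (play j a M)) :
    Realizes (player j (fun a => ofForest (FA a) (hne a)) :: FN) M := by
  have hinN : ∀ T ∈ FN, ∀ k s, T.HasNode k s → ∃ x ∈ M, j ∉ infos x ∧ k ∈ infos x := by
    intro T hT k s h
    obtain ⟨x, hx, hk⟩ := h.exists_mem_bag
    have := Multiset.mem_filter.1 (hN.mem.2 ⟨T, hT, hx⟩)
    exact ⟨x, this.1, this.2, hk⟩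
  have hinA : ∀ a, ∀ T ∈ FA a, ∀ k s, T.HasNode k s →
      k ≠ j ∧ ∃ x ∈ M, j ∈ infos x ∧ k ∈ infos x := by
    intro a T hT k s h
    obtain ⟨x, hx, hk⟩ := h.exists_mem_bag
    obtain ⟨y, hy, rfl⟩ := Multiset.mem_map.1 ((hA a).mem.2 ⟨T, hT, hx⟩)
    have hy := Multiset.mem_filter.1 hy
    have hk := mem_infos_del.1 hk
    exact ⟨hk.2, y, hy.1, mem_infos.2 ⟨a, hy.2⟩, hk.1⟩
  obtain ⟨x₀, hx₀, hjx₀⟩ : ∃ x ∈ M, j ∈ infos x := by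
    obtain ⟨a⟩ := (inferInstance : Nonempty (Act j))
    obtain ⟨T, hT⟩ := List.exists_mem_of_ne_nil _ (hne a)
    obtain ⟨x, hx⟩ := GameStructure.exists_mem_bag T
    obtain ⟨y, hy, rfl⟩ := Multiset.mem_map.1 ((hA a).mem.2 ⟨T, hT, hx⟩)
    have hy := Multiset.mem_filter.1 hy
    exact ⟨y, hy.1, mem_infos.2 ⟨a, hy.2⟩⟩
  -- Below the root no node belongs to `j`, because `j` is deleted in all parts.
  have hroot : ∀ k s, (player j (fun a => ofForest (FA a) (hne a))).HasNode k s →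
      (k = j ∧ s = []) ∨ (k ≠ j ∧ ∃ a, ∃ T ∈ FA a, ∃ t, s = ⟨j, a⟩ :: t ∧ T.HasNode k t) := by
    rintro k s (h | ⟨a, t, rfl, h⟩)
    · exact Or.inl h
    · obtain ⟨T, hT, h'⟩ := hasNode_ofForest.1 h
      exact Or.inr ⟨(hinA a T hT k t h').1, a, T, hT, t, rfl, h'⟩
  have hin : ∀ k s, (player j (fun a => ofForest (FA a) (hne a))).HasNode k s →
      ∃ x ∈ M, j ∈ infos x ∧ k ∈ infos x := by
    intro k s h
    rcases hroot k s h with ⟨rfl, rfl⟩ | ⟨_, a, T, hT, t, rfl, h'⟩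
    · exact ⟨x₀, hx₀, hjx₀, hjx₀⟩
    · exact (hinA a T hT k t h').2
  have hdisj : ∀ k s, (player j (fun a => ofForest (FA a) (hne a))).HasNode k s →
      ∀ T ∈ FN, ∀ t, ¬ T.HasNode k t := by
    intro k s h T hT t ht
    obtain ⟨x, hx, hjx, hkx⟩ := hin k s h
    obtain ⟨y, hy, hjy, hky⟩ := hinN T hT k t ht
    exact hj x hx y hy hjx hjy k hkx hky
  refine ⟨?_, ?_⟩
  · intro T hT T' hT' k s t hs ht
    rcases List.mem_cons.1 hT with rfl | hT <;> rcases List.mem_cons.1 hT' with rfl | hT'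
    · rcases hroot k s hs with ⟨rfl, rfl⟩ | ⟨hk, a, U, hU, s', rfl, hs'⟩ <;>
        rcases hroot _ t ht with ⟨hk', rfl⟩ | ⟨hk', b, U', hU', t', rfl, ht'⟩
      · exact Or.inl rfl
      · exact absurd rfl hk'
      · exact absurd hk' hk
      · by_cases hab : a = b
        · subst hab
          rcases (hA a).1 U hU U' hU' k s' t' hs' ht' with rfl | h
          · exact Or.inl rfl
          · exact Or.inr (h.cons _)
        · exact Or.inr ⟨[], s', t', j, a, b, hab, rfl, rfl⟩
    · exact absurd ht (hdisj k s hs T' hT' t)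
    · exact absurd hs (hdisj k t ht T hT s)
    · exact hN.1 T hT T' hT' k s t hs ht
  · rw [List.map_cons, List.sum_cons, hN.2, bag]
    simp only [bag_ofForest, fun a => (hA a).2]
    exact sum_play_add j M hnd

/-! ### Witnesses -/

/-- Links the recursive `bag` to the leaves themselves, which the bijection in the definition of a
witness speaks of. -/
theorem sum_leafHist : ∀ (T : GameStructure Act) [Fintype T.Leaf],
    ∑ t : T.Leaf, ({(T.leafHist t : Multiset (Σ i, Act i))} : Multiset (Multiset (Σ i, Act i))) =
      T.bag
  | leaf, _ => by
    let e : (leaf : GameStructure Act).Leaf ≃ Unit := Equiv.refl _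
    rw [← Equiv.sum_comp e.symm]
    exact Fintype.sum_unique _
  | player i child, _ => by
    have : ∀ a, Fintype (child a).Leaf := fun a =>
      @Fintype.ofFinite _ (finite_leaf (child a))
    let e : (player i child).Leaf ≃ Σ a : Act i, (child a).Leaf := Equiv.refl _
    rw [← Equiv.sum_comp e.symm, Fintype.sum_sigma, bag]
    refine Finset.sum_congr rfl fun a _ => ?_
    rw [← sum_leafHist (child a), map_sum']
    exact Finset.sum_congr rfl fun t _ => by rw [Multiset.map_singleton]; rfl
  | chance n child, _ => by
    have : ∀ a, Fintype (child a).Leaf := fun a =>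
      @Fintype.ofFinite _ (finite_leaf (child a))
    let e : (chance n child).Leaf ≃ Σ a : Fin (n + 1), (child a).Leaf := Equiv.refl _
    rw [← Equiv.sum_comp e.symm, Fintype.sum_sigma, bag]
    exact Finset.sum_congr rfl fun a _ => sum_leafHist (child a)

theorem bag_eq_map (T : GameStructure Act) [Fintype T.Leaf] :
    T.bag = (Finset.univ : Finset T.Leaf).val.map
      (fun t => (T.leafHist t : Multiset (Σ i, Act i))) := by
  rw [← sum_leafHist, Finset.sum_eq_multiset_sum]
  conv_rhs => rw [← Multiset.sum_map_singleton (Multiset.map _ _), Multiset.map_map]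
  rfl

theorem card_bag (T : GameStructure Act) : T.bag.card = T.size := by
  have : Fintype T.Leaf := @Fintype.ofFinite _ (finite_leaf T)
  rw [bag_eq_map, Multiset.card_map, size, Nat.card_eq_fintype_card]
  rfl

/-- Equality of the image multisets says that fibres over each value have equal cardinality;
bijections of the fibres are glued. -/
theorem map_univ_eq_map_univ {α β γ : Type} [Fintype α] [Fintype β] (f : α → γ) (g : β → γ) :
    (Finset.univ : Finset α).val.map f = (Finset.univ : Finset β).val.map g ↔
      ∃ e : α ≃ β, ∀ a, g (e a) = f a := by
  classical
  constructor
  · intro h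
    have hc : ∀ c, Nonempty ({a // f a = c} ≃ {b // g b = c}) := by
      intro c
      have := congrArg (Multiset.count c) h
      rw [Multiset.count_map, Multiset.count_map] at this
      refine ⟨Fintype.equivOfCardEq ?_⟩
      rw [Fintype.card_subtype, Fintype.card_subtype]
      simpa [Finset.card, eq_comm] using this
    refine ⟨(Equiv.sigmaFiberEquiv f).symm.trans
      ((Equiv.sigmaCongrRight fun c => (hc c).some).trans (Equiv.sigmaFiberEquiv g)), fun a => ?_⟩
    exact ((hc (f a)).some ⟨a, rfl⟩).2
  · rintro ⟨e, he⟩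
    rw [← Multiset.map_univ_val_equiv e, Multiset.map_map]
    exact Multiset.map_congr rfl fun a _ => (he a).symm

/-- A history-preserving bijection up to permutation exists exactly when the bags agree, and this
already forces equal sizes. -/
theorem isShuffledWitness_iff (T T' : GameStructure Act) :
    T.IsShuffledWitness T' ↔ T'.ALossRecall ∧ T.bag = T'.bag := by
  have : Fintype T.Leaf := @Fintype.ofFinite _ (finite_leaf T)
  have : Fintype T'.Leaf := @Fintype.ofFinite _ (finite_leaf T')
  have key : (∃ f : T.Leaf ≃ T'.Leaf, ∀ t : T.Leaf, (T'.leafHist (f t)).Perm (T.leafHist t)) ↔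
      T.bag = T'.bag := by
    rw [bag_eq_map, bag_eq_map, map_univ_eq_map_univ]
    simp only [Multiset.coe_eq_coe]
  rw [IsShuffledWitness, key]
  constructor
  · rintro ⟨_, h⟩; exact h
  · intro h; exact ⟨by rw [← card_bag, ← card_bag, h.2], h⟩

theorem HasShuffledALossRecall.exists_realizes {T : GameStructure Act}
    (h : T.HasShuffledALossRecall) : ∃ F, Realizes F T.bag := by
  obtain ⟨T', h⟩ := h
  obtain ⟨h, hb⟩ := (isShuffledWitness_iff T T').1 h
  refine ⟨[T'], ?_, by simp [hb]⟩
  intro U hU U' hU'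
  rw [List.mem_singleton.1 hU, List.mem_singleton.1 hU']
  exact (aLossRecall_iff T').1 h

theorem Realizes.isShuffledWitness {T : GameStructure Act} {F : List (GameStructure Act)}
    (h : Realizes F T.bag) (hF : F ≠ []) : T.IsShuffledWitness (ofForest F hF) := by
  rw [isShuffledWitness_iff, aLossRecall_iff, bag_ofForest, h.2]
  refine ⟨fun k s t hs ht => ?_, rfl⟩
  obtain ⟨U, hU, hs⟩ := hasNode_ofForest.1 hs
  obtain ⟨U', hU', ht⟩ := hasNode_ofForest.1 ht
  exact h.1 U hU U' hU' k s t hs ht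

theorem nodup_infos_of_mem_bag {T : GameStructure Act} (hT : T.NonAbsentminded) {x}
    (hx : x ∈ T.bag) : (infos x).Nodup := by
  have : Fintype T.Leaf := @Fintype.ofFinite _ (finite_leaf T)
  rw [bag_eq_map] at hx
  obtain ⟨t, _, rfl⟩ := Multiset.mem_map.1 hx
  rw [infos, Multiset.map_coe, Multiset.coe_nodup]
  exact hT t

end GameStructure

/-! ### The program -/

namespace LExpr

/-- The expression for `true`. -/
def tt : LExpr := cons nil nil

/-- Body of the function `s` that maps `(c . l)` to whether the test `k` holds for `(c . x)` with
some element `x` of the list `l`. -/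
def anyBody (s k : ℕ) : LExpr :=
  ifCons (tail (var 0))
    (ifCons (call k (cons (head (var 0)) (head (tail (var 0))))) tt
      (call s (cons (head (var 0)) (tail (tail (var 0))))))
    nil

/-- Body of the function `s` that maps `(c . l)` to the list of the elements `x` of `l` for which
the test `k` holds for `(c . x)`. -/
def filterBody (s k : ℕ) : LExpr :=
  ifCons (tail (var 0))
    (ifCons (call k (cons (head (var 0)) (head (tail (var 0)))))
      (cons (head (tail (var 0))) (call s (cons (head (var 0)) (tail (tail (var 0))))))
      (call s (cons (head (var 0)) (tail (tail (var 0))))))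
    nil

/-- Body of the function `s` that maps `(c . l)` to the list of the values of the function `k` at
`(c . x)` for the elements `x` of `l`. -/
def mapBody (s k : ℕ) : LExpr :=
  ifCons (tail (var 0))
    (cons (call k (cons (head (var 0)) (head (tail (var 0)))))
      (call s (cons (head (var 0)) (tail (tail (var 0))))))
    nil

/-- `(x . y)`: equality of `x` and `y`. -/
def eqBody : LExpr :=
  ifCons (head (var 0))
    (ifCons (tail (var 0))
      (ifCons (call 1 (cons (head (head (var 0))) (head (tail (var 0)))))
        (call 1 (cons (tail (head (var 0))) (tail (tail (var 0))))) nil)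
      nil)
    (ifCons (tail (var 0)) nil tt)

/-- `(j . e)`: the entry `e` belongs to the information set `j`. -/
def entryInBody : LExpr := call 1 (cons (head (var 0)) (head (tail (var 0))))

/-- Negation of the test `k`. -/
def notBody (k : ℕ) : LExpr := ifCons (call k (var 0)) nil tt

/-- `(u . h)`: the entries of `h` with new information sets are added to `u`. -/
def addBody : LExpr :=
  ifCons (tail (var 0))
    (ifCons (call 4 (cons (head (head (tail (var 0)))) (head (var 0))))
      (call 12 (cons (head (var 0)) (tail (tail (var 0)))))
      (call 12 (cons (cons (head (tail (var 0))) (head (var 0))) (tail (tail (var 0))))))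
    (head (var 0))

/-- `(u . M)`: all histories of `M` are added to `u`. -/
def addAllBody : LExpr :=
  ifCons (tail (var 0))
    (call 13 (cons (call 12 (cons (head (var 0)) (head (tail (var 0))))) (tail (tail (var 0)))))
    (head (var 0))

/-- `(u . e)`: the information set of the entry `e` occurs in `u`. -/
def occursBody : LExpr := call 4 (cons (head (tail (var 0))) (head (var 0)))

/-- `(M . e)`: the information set of the entry `e` can be moved to the root for `M`. -/
def closedBody : LExpr :=
  letIn (call 7 (cons (head (tail (var 0))) (head (var 0))))
    (ifCons (call 16 (cons (call 13 (cons nil (var 0)))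
      (call 8 (cons (head (tail (var 1))) (head (var 1))))))
      nil tt)

/-- `(j . (a . (b . M)))`: the list of the subtrees for the actions `a, …, a + b - 1` of `j`. -/
def actionsBody : LExpr :=
  ifCons (head (tail (tail (var 0))))
    (letIn (call 20 (call 11 (cons (head (var 0))
        (call 10 (cons (cons (head (var 0)) (head (tail (var 0)))) (tail (tail (tail (var 0)))))))))
      (ifCons (var 0)
        (ifCons (tail (var 0))
          (letIn (call 19 (cons (head (var 1)) (cons (cons nil (head (tail (var 1))))
              (cons (tail (head (tail (tail (var 1))))) (tail (tail (tail (var 1))))))))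
            (ifCons (var 0) (cons nil (cons (cons nil (tail (var 1))) (tail (var 0)))) nil))
          nil)
        nil))
    tt

/-- `M`: a forest for the histories in `M`. -/
def forestBody : LExpr :=
  ifCons (var 0)
    (ifCons (head (var 0))
      (letIn (call 18 (cons (var 0) (head (var 0))))
        (ifCons (var 0)
          (letIn (head (head (var 0)))
            (letIn (call 20 (call 8 (cons (var 0) (var 2))))
              (ifCons (var 0)
                (letIn (call 19 (cons (var 1) (cons nil (cons (tail (var 1))
                    (call 7 (cons (var 1) (var 3)))))))
                  (ifCons (var 0)
                    (cons nil (cons (cons (head (var 2)) (tail (var 0))) (tail (var 1))))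
                    nil))
                nil)))
          nil))
      (letIn (call 20 (tail (var 0)))
        (ifCons (var 0) (cons nil (cons nil (tail (var 0)))) nil)))
    tt

/-- The length of a list. -/
def lengthBody : LExpr :=
  ifCons (var 0) (cons nil (call 21 (tail (var 0)))) nil

/-- `(T . (h . M))`: the leaf histories of `T`, prolonged by `h`, are added to `M`. -/
def gatherBody : LExpr :=
  ifCons (head (var 0))
    (ifCons (head (head (var 0)))
      (call 23 (cons (cons (cons (head (head (var 0))) (call 21 (tail (head (var 0))))) nil)
        (cons (tail (head (var 0))) (tail (var 0)))))
      (call 24 (cons (tail (head (var 0))) (tail (var 0)))))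
    (tail (var 0))

/-- `((j . a) . (l . (h . M)))`: the same for the list `l` of the children of a node of `j`. -/
def gatherPlayerBody : LExpr :=
  ifCons (head (tail (var 0)))
    (call 22 (cons (head (head (tail (var 0))))
      (cons (cons (head (var 0)) (head (tail (tail (var 0)))))
        (call 23 (cons (cons (head (head (var 0))) (cons nil (tail (head (var 0)))))
          (cons (tail (head (tail (var 0)))) (tail (tail (var 0)))))))))
    (tail (tail (tail (var 0))))

/-- `(l . (h . M))`: the same for the list `l` of the children of a chance node. -/
def gatherChanceBody : LExpr :=
  ifCons (head (var 0))
    (call 22 (cons (head (head (var 0)))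
      (cons (head (tail (var 0)))
        (call 24 (cons (tail (head (var 0))) (tail (var 0)))))))
    (tail (tail (var 0)))

/-- The main function. -/
def mainBody : LExpr :=
  letIn (call 20 (call 22 (cons (var 0) (cons nil nil))))
    (ifCons (var 0) (cons nil (cons nil (tail (var 0)))) nil)

end LExpr

open LExpr in
/-- The program that decides shuffled A-loss recall. -/
def alrProgram : LProgram :=
  [mainBody, eqBody, entryInBody, notBody 2, anyBody 4 2, anyBody 5 1, notBody 4, filterBody 7 4,
    filterBody 8 6, filterBody 9 3, filterBody 10 5, mapBody 11 9, addBody, addAllBody, occursBody,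
    anyBody 15 14, anyBody 16 15, closedBody, filterBody 18 17, actionsBody, forestBody,
    lengthBody, gatherBody, gatherPlayerBody, gatherChanceBody]

/-! ### Evaluation with a bound on the number of steps -/

/-- `e` evaluates to `v` in at most `n` steps. -/
def Ev (env : List LData) (e : LExpr) (v : LData) (n : ℕ) : Prop :=
  ∃ k ≤ n, LEval alrProgram env e v k

/-- The function `f` maps `x` to `y` in at most `n` steps. -/
def Runs (f : ℕ) (x y : LData) (n : ℕ) : Prop :=
  ∃ e, alrProgram[f]? = some e ∧ Ev [x] e y n

theorem Runs.mono {f x y n n'} (h : Runs f x y n) (hn : n ≤ n') : Runs f x y n' := by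
  obtain ⟨e, he, k, hk, h⟩ := h
  exact ⟨e, he, k, hk.trans hn, h⟩

namespace Ev

variable {env : List LData} {e e₁ e₂ c : LExpr} {v v' w x y z : LData} {n n' n₁ n₂ : ℕ}

theorem mono (h : Ev env e v n) (hn : n ≤ n') : Ev env e v n' := by
  obtain ⟨k, hk, h⟩ := h
  exact ⟨k, hk.trans hn, h⟩

theorem v0 : Ev (x :: env) (.var 0) x 1 := ⟨1, le_rfl, .var rfl⟩

theorem v1 : Ev (y :: x :: env) (.var 1) x 1 := ⟨1, le_rfl, .var rfl⟩

theorem v2 : Ev (z :: y :: x :: env) (.var 2) x 1 := ⟨1, le_rfl, .var rfl⟩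

theorem v3 : Ev (w :: z :: y :: x :: env) (.var 3) x 1 := ⟨1, le_rfl, .var rfl⟩

theorem nil : Ev env .nil .nil 1 := ⟨1, le_rfl, .nil⟩

theorem cons (h₁ : Ev env e₁ v n₁) (h₂ : Ev env e₂ w n₂) :
    Ev env (.cons e₁ e₂) (.cons v w) (n₁ + n₂ + 1) := by
  obtain ⟨k₁, hk₁, h₁⟩ := h₁
  obtain ⟨k₂, hk₂, h₂⟩ := h₂
  exact ⟨_, by omega, .cons h₁ h₂⟩

theorem tt : Ev env LExpr.tt (.cons .nil .nil) 3 := cons nil nil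

theorem head (h : Ev env e (.cons v w) n) : Ev env (.head e) v (n + 1) := by
  obtain ⟨k, hk, h⟩ := h
  exact ⟨_, by omega, .head h⟩

theorem tail (h : Ev env e (.cons v w) n) : Ev env (.tail e) w (n + 1) := by
  obtain ⟨k, hk, h⟩ := h
  exact ⟨_, by omega, .tail h⟩

theorem ifTrue (h₁ : Ev env c (.cons x y) n₁) (h₂ : Ev env e₁ v n₂) :
    Ev env (.ifCons c e₁ e₂) v (n₁ + n₂ + 1) := by
  obtain ⟨k₁, hk₁, h₁⟩ := h₁
  obtain ⟨k₂, hk₂, h₂⟩ := h₂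
  exact ⟨_, by omega, .ifTrue h₁ h₂⟩

theorem ifFalse (h₁ : Ev env c .nil n₁) (h₂ : Ev env e₂ v n₂) :
    Ev env (.ifCons c e₁ e₂) v (n₁ + n₂ + 1) := by
  obtain ⟨k₁, hk₁, h₁⟩ := h₁
  obtain ⟨k₂, hk₂, h₂⟩ := h₂
  exact ⟨_, by omega, .ifFalse h₁ h₂⟩

theorem letIn (h₁ : Ev env e₁ v n₁) (h₂ : Ev (v :: env) e₂ w n₂) :
    Ev env (.letIn e₁ e₂) w (n₁ + n₂ + 1) := by
  obtain ⟨k₁, hk₁, h₁⟩ := h₁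
  obtain ⟨k₂, hk₂, h₂⟩ := h₂
  exact ⟨_, by omega, .letIn h₁ h₂⟩

theorem call {f : ℕ} (h₂ : Runs f x y n₂) (h₁ : Ev env e x n₁) :
    Ev env (.call f e) y (n₁ + n₂ + 1) := by
  obtain ⟨k₁, hk₁, h₁⟩ := h₁
  obtain ⟨b, hb, k₂, hk₂, h₂⟩ := h₂
  exact ⟨_, by omega, .call hb h₁ h₂⟩

end Ev

theorem Runs.of_ev {f x y n n'} (e : LExpr) (he : alrProgram[f]? = some e) (h : Ev [x] e y n)
    (hn : n ≤ n') : Runs f x y n' :=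
  ⟨e, he, h.mono hn⟩

/-! ### S-expressions: size, numerals and equality test -/

namespace LData

/-- Truth values. -/
def ofBool : Bool → LData
  | true => cons nil nil
  | false => nil

/-- The number of nodes. -/
def size : LData → ℕ
  | nil => 1
  | cons x y => x.size + y.size + 1

/-- The S-expression of a list. -/
def enc {α : Type} (f : α → LData) (l : List α) : LData := ofList (l.map f)

theorem size_ofNat (n : ℕ) : (ofNat n).size = 2 * n + 1 := by
  induction n with
  | zero => rfl
  | succ n ih => simp only [ofNat, size, ih]; omega

theorem ofNat_injective : Function.Injective ofNat := by
  intro m n h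
  have := congrArg size h
  rw [size_ofNat, size_ofNat] at this
  omega

noncomputable instance : DecidableEq LData := Classical.decEq _

end LData

open LData

/-- Charged to `x` alone: the recursion descends along `x` and stops at the first mismatch, however
large `y` is. -/
theorem runs_eq (x y : LData) : Runs 1 (cons x y) (ofBool (decide (x = y))) (40 * x.size) := by
  induction x generalizing y with
  | nil =>
    cases y with
    | nil =>
      rw [decide_eq_true rfl]
      exact .of_ev _ rfl (.ifFalse (.head .v0) (.ifFalse (.tail .v0) .tt)) (by simp [LData.size])
    | cons y₁ y₂ =>
      rw [decide_eq_false (by simp)]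
      exact .of_ev _ rfl (.ifFalse (.head .v0) (.ifTrue (.tail .v0) .nil)) (by simp [LData.size])
  | cons x₁ x₂ ih₁ ih₂ =>
    cases y with
    | nil =>
      rw [decide_eq_false (by simp)]
      exact .of_ev _ rfl (.ifTrue (.head .v0) (.ifFalse (.tail .v0) .nil))
        (by simp only [LData.size]; omega)
    | cons y₁ y₂ =>
      have h₁ := ih₁ y₁
      by_cases h : x₁ = y₁
      · rw [decide_eq_true h] at h₁
        have : decide (cons x₁ x₂ = cons y₁ y₂) = decide (x₂ = y₂) := by simp [h]
        rw [this]
        exact .of_ev _ rfl (.ifTrue (.head .v0) (.ifTrue (.tail .v0)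
          (.ifTrue (.call h₁ (.cons (.head (.head .v0)) (.head (.tail .v0))))
            (.call (ih₂ y₂) (.cons (.tail (.head .v0)) (.tail (.tail .v0)))))))
          (by simp only [LData.size]; omega)
      · rw [decide_eq_false h] at h₁
        rw [decide_eq_false (by simp [h])]
        exact .of_ev _ rfl (.ifTrue (.head .v0) (.ifTrue (.tail .v0)
          (.ifFalse (.call h₁ (.cons (.head (.head .v0)) (.head (.tail .v0)))) .nil)))
          (by simp only [LData.size]; omega)

theorem runs_not {f k : ℕ} (hf : alrProgram[f]? = some (LExpr.notBody k)) {x : LData} {b : Bool}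
    {B : ℕ} (h : Runs k x (ofBool b) B) : Runs f x (ofBool !b) (B + 10) := by
  cases b with
  | true => exact .of_ev _ hf (.ifTrue (.call h .v0) .nil) (by omega)
  | false => exact .of_ev _ hf (.ifFalse (.call h .v0) .tt) (by omega)

/-! ### Running times of the generic list functions -/

section Lists

variable {α β : Type} {f : α → LData} {c : LData} {B : ℕ}

theorem runs_any {s k : ℕ} (hs : alrProgram[s]? = some (LExpr.anyBody s k)) {p : α → Bool}
    {l : List α} (h : ∀ x ∈ l, Runs k (cons c (f x)) (ofBool (p x)) B) :
    Runs s (cons c (enc f l)) (ofBool (l.any p)) ((B + 40) * (l.length + 1)) := by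
  induction l with
  | nil => exact .of_ev _ hs (.ifFalse (.tail .v0) .nil) (by simp)
  | cons x l ih =>
    have hx := h x List.mem_cons_self
    have ih := ih fun y hy => h y (List.mem_cons_of_mem _ hy)
    have hb : (B + 40) * (l.length + 1 + 1) = (B + 40) * (l.length + 1) + B + 40 := by ring
    rw [List.any_cons, List.length_cons, hb]
    cases hp : p x with
    | true =>
      rw [hp] at hx
      exact .of_ev _ hs (.ifTrue (.tail .v0)
        (.ifTrue (.call hx (.cons (.head .v0) (.head (.tail .v0)))) .tt)) (by omega)
    | false =>
      rw [hp] at hx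
      exact .of_ev _ hs (.ifTrue (.tail .v0)
        (.ifFalse (.call hx (.cons (.head .v0) (.head (.tail .v0))))
          (.call ih (.cons (.head .v0) (.tail (.tail .v0)))))) (by omega)

theorem runs_filter {s k : ℕ} (hs : alrProgram[s]? = some (LExpr.filterBody s k)) {p : α → Bool}
    {l : List α} (h : ∀ x ∈ l, Runs k (cons c (f x)) (ofBool (p x)) B) :
    Runs s (cons c (enc f l)) (enc f (l.filter p)) ((B + 40) * (l.length + 1)) := by
  induction l with
  | nil => exact .of_ev _ hs (.ifFalse (.tail .v0) .nil) (by simp)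
  | cons x l ih =>
    have hx := h x List.mem_cons_self
    have ih := ih fun y hy => h y (List.mem_cons_of_mem _ hy)
    have hb : (B + 40) * (l.length + 1 + 1) = (B + 40) * (l.length + 1) + B + 40 := by ring
    rw [List.length_cons, hb]
    cases hp : p x with
    | true =>
      rw [hp] at hx
      rw [List.filter_cons_of_pos hp]
      exact .of_ev _ hs (.ifTrue (.tail .v0)
        (.ifTrue (.call hx (.cons (.head .v0) (.head (.tail .v0))))
          (.cons (.head (.tail .v0)) (.call ih (.cons (.head .v0) (.tail (.tail .v0)))))))
        (by omega)
    | false =>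
      rw [hp] at hx
      rw [List.filter_cons_of_neg (by simp [hp])]
      exact .of_ev _ hs (.ifTrue (.tail .v0)
        (.ifFalse (.call hx (.cons (.head .v0) (.head (.tail .v0))))
          (.call ih (.cons (.head .v0) (.tail (.tail .v0)))))) (by omega)

theorem runs_map {s k : ℕ} (hs : alrProgram[s]? = some (LExpr.mapBody s k)) {g : β → LData}
    {p : α → β} {l : List α} (h : ∀ x ∈ l, Runs k (cons c (f x)) (g (p x)) B) :
    Runs s (cons c (enc f l)) (enc g (l.map p)) ((B + 40) * (l.length + 1)) := by
  induction l with
  | nil => exact .of_ev _ hs (.ifFalse (.tail .v0) .nil) (by simp)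
  | cons x l ih =>
    have hx := h x List.mem_cons_self
    have ih := ih fun y hy => h y (List.mem_cons_of_mem _ hy)
    have hb : (B + 40) * (l.length + 1 + 1) = (B + 40) * (l.length + 1) + B + 40 := by ring
    rw [List.length_cons, hb]
    exact .of_ev _ hs (.ifTrue (.tail .v0)
      (.cons (.call hx (.cons (.head .v0) (.head (.tail .v0))))
        (.call ih (.cons (.head .v0) (.tail (.tail .v0)))))) (by omega)

theorem runs_length (l : List α) :
    Runs 21 (enc f l) (ofNat l.length) (10 * l.length + 10) := by
  induction l with
  | nil => exact .of_ev _ rfl (.ifFalse .v0 .nil) (by omega)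
  | cons x l ih =>
    exact .of_ev _ rfl (.ifTrue .v0 (.cons .nil (.call ih (.tail .v0))))
      (by simp only [List.length_cons]; omega)

end Lists

/-! ### Histories as lists -/

namespace GameStructure

variable {ι : Type} {Act : ι → Type} [DecidableEq ι]

/-- The information set `j` occurs in the history `h`. -/
def hasInfo (j : ι) (h : List (Σ i, Act i)) : Bool := h.any fun e => decide (e.1 = j)

theorem hasInfo_iff {j : ι} {h : List (Σ i, Act i)} :
    hasInfo j h = true ↔ j ∈ infos (h : Multiset (Σ i, Act i)) := by
  simp [hasInfo, infos]

/-- The entries of `h` with new information sets are added to `u`. -/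
def addInfos (u h : List (Σ i, Act i)) : List (Σ i, Act i) :=
  h.foldl (fun u e => if hasInfo e.1 u = true then u else e :: u) u

theorem hasInfo_addInfos {k : ι} {u h : List (Σ i, Act i)} :
    hasInfo k (addInfos u h) = true ↔ hasInfo k u = true ∨ hasInfo k h = true := by
  induction h generalizing u with
  | nil => simp [addInfos, hasInfo]
  | cons e h ih =>
    have : addInfos u (e :: h) = addInfos (if hasInfo e.1 u = true then u else e :: u) h := rfl
    rw [this, ih]
    have hc : ∀ l : List (Σ i, Act i), hasInfo k (e :: l) = true ↔ e.1 = k ∨ hasInfo k l = true :=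
      fun l => by simp [hasInfo]
    rw [hc]
    split_ifs with hu
    · constructor
      · tauto
      · rintro (h | rfl | h)
        · exact Or.inl h
        · exact Or.inl hu
        · exact Or.inr h
    · rw [hc]; tauto

theorem nodup_addInfos {u h : List (Σ i, Act i)} (hu : (u.map Sigma.fst).Nodup) :
    ((addInfos u h).map Sigma.fst).Nodup := by
  induction h generalizing u with
  | nil => exact hu
  | cons e h ih =>
    have : addInfos u (e :: h) = addInfos (if hasInfo e.1 u = true then u else e :: u) h := rfl
    rw [this]
    apply ih
    split_ifs with he
    · exact hu
    · rw [List.map_cons, List.nodup_cons]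
      refine ⟨?_, hu⟩
      rw [hasInfo_iff] at he
      simpa [infos] using he

/-- The entries of all histories in `M` with new information sets are added to `u`. -/
def addAllInfos (u : List (Σ i, Act i)) (M : List (List (Σ i, Act i))) : List (Σ i, Act i) :=
  M.foldl addInfos u

theorem hasInfo_addAllInfos {k : ι} {u : List (Σ i, Act i)} {M : List (List (Σ i, Act i))} :
    hasInfo k (addAllInfos u M) = true ↔ hasInfo k u = true ∨ ∃ h ∈ M, hasInfo k h = true := by
  induction M generalizing u with
  | nil => simp [addAllInfos]
  | cons h M ih =>
    have : addAllInfos u (h :: M) = addAllInfos (addInfos u h) M := rfl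
    rw [this, ih, hasInfo_addInfos]
    simp [or_assoc]

theorem nodup_addAllInfos {u : List (Σ i, Act i)} {M : List (List (Σ i, Act i))}
    (hu : (u.map Sigma.fst).Nodup) : ((addAllInfos u M).map Sigma.fst).Nodup := by
  induction M generalizing u with
  | nil => exact hu
  | cons h M ih => exact ih (nodup_addInfos hu)

/-- The information set `j` can be moved to the root. -/
def isClosed (M : List (List (Σ i, Act i))) (j : ι) : Bool :=
  !((M.filter fun h => !hasInfo j h).any fun h =>
    h.any fun e => hasInfo e.1 (addAllInfos [] (M.filter (hasInfo j))))

/-- A list of histories as a multiset of histories up to permutation. -/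
def toBag (M : List (List (Σ i, Act i))) : Multiset (Multiset (Σ i, Act i)) :=
  Multiset.ofList (M.map Multiset.ofList)

theorem toBag_cons (h : List (Σ i, Act i)) (M : List (List (Σ i, Act i))) :
    toBag (h :: M) = (h : Multiset (Σ i, Act i)) ::ₘ toBag M := rfl

theorem mem_toBag {M : List (List (Σ i, Act i))} {x} :
    x ∈ toBag M ↔ ∃ h ∈ M, (h : Multiset (Σ i, Act i)) = x := by
  simp only [toBag, Multiset.mem_coe, List.mem_map]

theorem forall_mem_toBag {M : List (List (Σ i, Act i))} {p : Multiset (Σ i, Act i) → Prop} :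
    (∀ x ∈ toBag M, p x) ↔ ∀ h ∈ M, p (h : Multiset (Σ i, Act i)) := by
  simp only [mem_toBag]
  exact ⟨fun H h hh => H _ ⟨h, hh, rfl⟩, fun H x ⟨h, hh, hx⟩ => hx ▸ H h hh⟩

theorem toBag_filter (M : List (List (Σ i, Act i))) (p : List (Σ i, Act i) → Bool)
    (q : Multiset (Σ i, Act i) → Prop) [DecidablePred q]
    (h : ∀ l : List (Σ i, Act i), p l = true ↔ q l) :
    toBag (M.filter p) = (toBag M).filter q := by
  induction M with
  | nil => rfl
  | cons l M ih =>
    rw [toBag_cons]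
    by_cases hl : p l = true
    · rw [List.filter_cons_of_pos hl, Multiset.filter_cons_of_pos _ ((h l).1 hl), toBag_cons, ih]
    · rw [List.filter_cons_of_neg hl,
        Multiset.filter_cons_of_neg _ (fun hq => hl ((h l).2 hq)), ih]

/-- `Closed` with its quantifiers reordered: the information sets of all histories through `j` are
collected once, and the remaining histories are scanned against this collection. -/
theorem isClosed_iff {M : List (List (Σ i, Act i))} {j : ι} :
    isClosed M j = true ↔ Closed j (toBag M) := by
  have : isClosed M j = true ↔ ∀ y ∈ M, hasInfo j y = false → ∀ e ∈ y, ∀ x ∈ M,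
      hasInfo j x = true → ¬ hasInfo e.1 x = true := by
    rw [isClosed, Bool.not_eq_true', List.any_eq_false]
    simp only [List.mem_filter, Bool.not_eq_true', List.any_eq_true, hasInfo_addAllInfos,
      and_imp, not_exists, not_and, not_or]
    constructor
    · intro H y hy hj e he x hx hjx
      exact (H y hy hj e he).2 x hx hjx
    · intro H y hy hj e he
      exact ⟨by simp [hasInfo], H y hy hj e he⟩
  rw [this, Closed, forall_mem_toBag]
  simp only [forall_mem_toBag (M := M), ← hasInfo_iff]
  constructor
  · intro H x hx y hy hjx hjy i hi hiy
    obtain ⟨e, he, hei⟩ := List.any_eq_true.1 hiy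
    have := H y hy (by simpa using hjy) e he x hx hjx
    rw [of_decide_eq_true hei] at this
    exact this hi
  · intro H y hy hjy e he x hx hjx hex
    exact H x hx y hy hjx (by simp [hjy]) e.1 hex (by
      rw [hasInfo, List.any_eq_true]; exact ⟨e, he, by simp⟩)

/-! ### Playing an action on lists of histories -/

variable [∀ i, DecidableEq (Act i)]

/-- The histories of `M` that contain the entry `e`, without the information set of `e`. -/
def playList (e : Σ i, Act i) (M : List (List (Σ i, Act i))) : List (List (Σ i, Act i)) :=
  (M.filter fun h => h.any fun e' => decide (e = e')).map
    fun h => h.filter fun e' => !decide (e'.1 = e.1)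

theorem toBag_playList (j : ι) (a : Act j) (M : List (List (Σ i, Act i))) :
    toBag (playList ⟨j, a⟩ M) = play j a (toBag M) := by
  rw [play, ← toBag_filter M (fun h => h.any fun e' => decide (⟨j, a⟩ = e')) _ (by simp)]
  simp only [toBag, playList, Multiset.map_coe, List.map_map]
  congr 1
  apply List.map_congr_left
  intro h _
  simp [del]

/-- The program passes only the histories through `j` to the loop over the actions; nothing is lost.
-/
theorem playList_filter (j : ι) (a : Act j) (M : List (List (Σ i, Act i))) :
    playList ⟨j, a⟩ (M.filter (hasInfo j)) = playList ⟨j, a⟩ M := by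
  rw [playList, playList, List.filter_filter]
  congr 2
  funext h
  rw [Bool.and_eq_left_iff_imp]
  intro H
  obtain ⟨e, he, h'⟩ := List.any_eq_true.1 H
  rw [← of_decide_eq_true h'] at he
  exact List.any_eq_true.2 ⟨_, he, by simp⟩

theorem mem_playList {e : Σ i, Act i} {M : List (List (Σ i, Act i))} {h : List (Σ i, Act i)}
    (hh : h ∈ playList e M) :
    ∃ g ∈ M, e ∈ g ∧ h = g.filter fun e' => !decide (e'.1 = e.1) := by
  obtain ⟨g, hg, rfl⟩ := List.mem_map.1 hh
  rw [List.mem_filter, List.any_eq_true] at hg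
  obtain ⟨hg, e', he', h⟩ := hg
  rw [of_decide_eq_true h]
  exact ⟨g, hg, he', rfl⟩

/-- The histories in `M` repeat no information set and use only those in `S`. -/
def GoodList (S : Finset ι) (M : List (List (Σ i, Act i))) : Prop :=
  ∀ h ∈ M, (h.map Sigma.fst).Nodup ∧ ∀ e ∈ h, e.1 ∈ S

theorem GoodList.filter {S : Finset ι} {M : List (List (Σ i, Act i))} (h : GoodList S M)
    (p : List (Σ i, Act i) → Bool) : GoodList S (M.filter p) :=
  fun g hg => h g (List.mem_filter.1 hg).1

theorem GoodList.filter_erase {S : Finset ι} {M : List (List (Σ i, Act i))} (h : GoodList S M)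
    (j : ι) : GoodList (S.erase j) (M.filter fun h => !hasInfo j h) := by
  intro g hg
  obtain ⟨hg, hj⟩ := List.mem_filter.1 hg
  refine ⟨(h g hg).1, fun e he => Finset.mem_erase.2 ⟨?_, (h g hg).2 e he⟩⟩
  rintro rfl
  have : hasInfo e.1 g = true := List.any_eq_true.2 ⟨e, he, by simp⟩
  simp [this] at hj

theorem GoodList.playList {S : Finset ι} {M : List (List (Σ i, Act i))} (h : GoodList S M)
    (e : Σ i, Act i) : GoodList (S.erase e.1) (playList e M) := by
  intro g hg
  obtain ⟨g', hg', _, rfl⟩ := mem_playList hg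
  refine ⟨(h g' hg').1.sublist (List.filter_sublist.map _), fun e' he' => ?_⟩
  obtain ⟨he', hne⟩ := List.mem_filter.1 he'
  exact Finset.mem_erase.2 ⟨by simpa using hne, (h g' hg').2 e' he'⟩

theorem GoodList.nodup_infos {S : Finset ι} {M : List (List (Σ i, Act i))} (h : GoodList S M) :
    ∀ x ∈ toBag M, (infos x).Nodup := by
  rw [forall_mem_toBag]
  intro g hg
  simpa [infos] using (h g hg).1

/-- Cardinalities in `sum_play_add`: the recursive calls share out the histories of `M` without
duplication. This keeps the recursion linear in their number. -/
theorem sum_length_playList [∀ i, Fintype (Act i)] {S : Finset ι}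
    {M : List (List (Σ i, Act i))} (h : GoodList S M) (j : ι) :
    ∑ a : Act j, (playList ⟨j, a⟩ M).length + (M.filter fun h => !hasInfo j h).length
      = M.length := by
  have := congrArg Multiset.card (sum_play_add j (toBag M) h.nodup_infos)
  rw [Multiset.card_add, Multiset.card_sum] at this
  simp only [Multiset.card_map, ← toBag_playList] at this
  rw [← toBag_filter M (fun h => !hasInfo j h) _ (by
    intro l; rw [← hasInfo_iff]; simp)] at this
  simpa [toBag] using this

end GameStructure

/-! ### Step bounds as polynomials in the number `K` of actions -/

namespace StepBound

variable {R : Type} [CommSemiring R]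

/-- Bound for the comparison of two entries. -/
def eq (K : R) : R := 40 * (6 * K + 5)

/-- Bound for membership in a history. -/
def has (K : R) : R := (eq K + 100) * (K + 1)

/-- Bound for the deletion of an information set from a history. -/
def del (K : R) : R := (eq K + 100) * (K + 1)

/-- Bound for adding a history to a list of information sets. -/
def add (K : R) : R := (has K + 50) * (K + 1)

/-- Bound for the comparison of a history with a list of information sets. -/
def meets (K : R) : R := (has K + 100) * (K + 1)

/-- Bound per history for the test whether an information set can be moved to the root. -/
def closed (K : R) : R := 2 * has K + add K + meets K + 400

/-- Bound per history for one level of the recursion. -/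
def level (K : R) : R := (closed K + 40) * (K + 1) + 2 * has K + (K + 1) * (has K + del K + 300) + 400

/-- Bound per history and information set for the construction of the forest. -/
def forest (K : R) : R := 2 * level K + 100 * (K + 1)

/-- Bound per leaf for the whole program. -/
def total (K : R) : R := forest K * (K + 1) + 200 * (K + 2) + 100

/-- The bounds are defined over any commutative semiring, so one formula serves as a polynomial at
`X` and as a number at `K`. -/
theorem eval_total (K : ℕ) : (total (Polynomial.X : Polynomial ℕ)).eval K = total K := by
  simp [total, forest, level, closed, meets, add, del, has, eq]

end StepBound

/-! ### Running times of the functions on histories -/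

section Histories

variable {m : ℕ} {ar : Fin m → ℕ}

/-- The S-expression of an information set together with its number of actions. -/
def encInfo (ar : Fin m → ℕ) (i : Fin m) : LData := cons (ofNat (i.val + 1)) (ofNat (ar i))

/-- The S-expression of an action. -/
def encEntry (e : Σ i, Fin (ar i)) : LData := cons (encInfo ar e.1) (ofNat e.2.val)

/-- The S-expression of a history. -/
def encHist (h : List (Σ i, Fin (ar i))) : LData := enc encEntry h

theorem encInfo_injective : Function.Injective (encInfo ar) := by
  intro i j h
  have := ofNat_injective (LData.cons.inj h).1
  exact Fin.ext (by omega)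

theorem encEntry_injective : Function.Injective (encEntry (ar := ar)) := by
  rintro ⟨i, a⟩ ⟨j, b⟩ h
  have h := LData.cons.inj h
  have hi : i = j := encInfo_injective h.1
  subst hi
  have := ofNat_injective h.2
  exact congrArg (Sigma.mk i) (Fin.ext this)

theorem arity_le_sum (i : Fin m) : ar i ≤ ∑ i, ar i :=
  Finset.single_le_sum (f := ar) (fun _ _ => Nat.zero_le _) (Finset.mem_univ i)

theorem card_le_sum (har : ∀ i, 0 < ar i) : m ≤ ∑ i, ar i := by
  calc m = ∑ _i : Fin m, 1 := by simp
    _ ≤ _ := Finset.sum_le_sum fun i _ => har i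

/-- Every information set has an action, so `m` is at most the number of actions. This is how
non-absentmindedness enters the time bound. -/
theorem length_le_of_nodup (har : ∀ i, 0 < ar i) {h : List (Σ i, Fin (ar i))}
    (hh : (h.map Sigma.fst).Nodup) : h.length ≤ ∑ i, ar i := by
  have := hh.length_le_card
  rw [List.length_map, Fintype.card_fin] at this
  exact this.trans (card_le_sum har)

theorem size_encInfo_le (har : ∀ i, 0 < ar i) (i : Fin m) :
    (encInfo ar i).size ≤ 4 * (∑ i, ar i) + 3 := by
  have := card_le_sum har
  have := arity_le_sum (ar := ar) i
  have := i.isLt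
  simp only [encInfo, LData.size, size_ofNat]
  omega

theorem size_encEntry_le (har : ∀ i, 0 < ar i) (e : Σ i, Fin (ar i)) :
    (encEntry e).size ≤ 6 * (∑ i, ar i) + 5 := by
  have := size_encInfo_le har e.1
  have := arity_le_sum (ar := ar) e.1
  have := e.2.isLt
  simp only [encEntry, LData.size, size_ofNat]
  omega

open GameStructure

variable (har : ∀ i, 0 < ar i)

include har

theorem runs_entryIn (j : Fin m) (e : Σ i, Fin (ar i)) :
    Runs 2 (cons (encInfo ar j) (encEntry e)) (ofBool (decide (e.1 = j)))
      (StepBound.eq (∑ i, ar i) + 20) := by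
  have h := runs_eq (encInfo ar j) (encInfo ar e.1)
  have hd : decide (encInfo ar j = encInfo ar e.1) = decide (e.1 = j) := by
    rw [decide_eq_decide, encInfo_injective.eq_iff, eq_comm]
  rw [hd] at h
  have := size_encInfo_le har j
  exact .of_ev _ rfl (.call h (.cons (.head .v0) (.head (.tail .v0))))
    (by simp only [StepBound.eq]; omega)

theorem runs_notEntryIn (j : Fin m) (e : Σ i, Fin (ar i)) :
    Runs 3 (cons (encInfo ar j) (encEntry e)) (ofBool !decide (e.1 = j))
      (StepBound.eq (∑ i, ar i) + 30) :=
  runs_not rfl (runs_entryIn har j e)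

theorem runs_has {h : List (Σ i, Fin (ar i))} (hh : (h.map Sigma.fst).Nodup) (j : Fin m) :
    Runs 4 (cons (encInfo ar j) (encHist h)) (ofBool (hasInfo j h))
      (StepBound.has (∑ i, ar i)) :=
  (runs_any rfl fun e _ => runs_entryIn har j e).mono
    (Nat.mul_le_mul (by omega) (by have := length_le_of_nodup har hh; omega))

theorem runs_contains {h : List (Σ i, Fin (ar i))} (hh : (h.map Sigma.fst).Nodup)
    (e : Σ i, Fin (ar i)) :
    Runs 5 (cons (encEntry e) (encHist h)) (ofBool (h.any fun e' => decide (e = e')))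
      (StepBound.has (∑ i, ar i)) := by
  refine (runs_any (B := StepBound.eq (∑ i, ar i)) rfl fun e' _ => ?_).mono
    (Nat.mul_le_mul (by omega) (by have := length_le_of_nodup har hh; omega))
  have h := runs_eq (encEntry e) (encEntry e')
  have hd : decide (encEntry e = encEntry e') = decide (e = e') := by
    rw [decide_eq_decide, encEntry_injective.eq_iff]
  rw [hd] at h
  have := size_encEntry_le har e
  exact h.mono (by simp only [StepBound.eq]; omega)

theorem runs_hasnt {h : List (Σ i, Fin (ar i))} (hh : (h.map Sigma.fst).Nodup) (j : Fin m) :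
    Runs 6 (cons (encInfo ar j) (encHist h)) (ofBool !hasInfo j h)
      (StepBound.has (∑ i, ar i) + 10) :=
  runs_not rfl (runs_has har hh j)

theorem runs_filterHas {S : Finset (Fin m)} {M : List (List (Σ i, Fin (ar i)))}
    (hM : GoodList S M) (j : Fin m) :
    Runs 7 (cons (encInfo ar j) (enc encHist M)) (enc encHist (M.filter (hasInfo j)))
      ((StepBound.has (∑ i, ar i) + 50) * (M.length + 1)) :=
  (runs_filter rfl fun h hh => runs_has har (hM h hh).1 j).mono
    (Nat.mul_le_mul (by omega) le_rfl)

theorem runs_filterHasnt {S : Finset (Fin m)} {M : List (List (Σ i, Fin (ar i)))}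
    (hM : GoodList S M) (j : Fin m) :
    Runs 8 (cons (encInfo ar j) (enc encHist M))
      (enc encHist (M.filter fun h => !hasInfo j h))
      ((StepBound.has (∑ i, ar i) + 50) * (M.length + 1)) :=
  runs_filter rfl fun h hh => runs_hasnt har (hM h hh).1 j

theorem runs_del {h : List (Σ i, Fin (ar i))} (hh : (h.map Sigma.fst).Nodup) (j : Fin m) :
    Runs 9 (cons (encInfo ar j) (encHist h)) (encHist (h.filter fun e => !decide (e.1 = j)))
      (StepBound.del (∑ i, ar i)) :=
  (runs_filter rfl fun e _ => runs_notEntryIn har j e).mono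
    (Nat.mul_le_mul (by omega) (by have := length_le_of_nodup har hh; omega))

theorem runs_filterContains {S : Finset (Fin m)} {M : List (List (Σ i, Fin (ar i)))}
    (hM : GoodList S M) (e : Σ i, Fin (ar i)) :
    Runs 10 (cons (encEntry e) (enc encHist M))
      (enc encHist (M.filter fun h => h.any fun e' => decide (e = e')))
      ((StepBound.has (∑ i, ar i) + 40) * (M.length + 1)) :=
  runs_filter rfl fun h hh => runs_contains har (hM h hh).1 e

theorem runs_mapDel {S : Finset (Fin m)} {M : List (List (Σ i, Fin (ar i)))}
    (hM : GoodList S M) (j : Fin m) :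
    Runs 11 (cons (encInfo ar j) (enc encHist M))
      (enc encHist (M.map fun h => h.filter fun e => !decide (e.1 = j)))
      ((StepBound.del (∑ i, ar i) + 40) * (M.length + 1)) :=
  runs_map rfl fun h hh => runs_del har (hM h hh).1 j

/-- The accumulator never repeats an information set, so its length stays below the number of
actions and every lookup costs at most `StepBound.has`. -/
theorem runs_addInfos {u : List (Σ i, Fin (ar i))} (hu : (u.map Sigma.fst).Nodup)
    (h : List (Σ i, Fin (ar i))) :
    Runs 12 (cons (encHist u) (encHist h)) (encHist (addInfos u h))
      ((StepBound.has (∑ i, ar i) + 50) * (h.length + 1)) := by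
  induction h generalizing u with
  | nil => exact .of_ev _ rfl (.ifFalse (.tail .v0) (.head .v0)) (by simp)
  | cons e h ih =>
    have hb : (StepBound.has (∑ i, ar i) + 50) * (h.length + 1 + 1) =
        (StepBound.has (∑ i, ar i) + 50) * (h.length + 1) + StepBound.has (∑ i, ar i) + 50 := by
      ring
    have hnd := nodup_addInfos (h := [e]) hu
    have heq : addInfos u (e :: h) = addInfos (addInfos u [e]) h := rfl
    have h1 : addInfos u [e] = if hasInfo e.1 u = true then u else e :: u := rfl
    have ih := ih hnd
    rw [heq, List.length_cons, hb]
    have hr := runs_has har hu e.1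
    by_cases hc : hasInfo e.1 u = true
    · rw [h1, if_pos hc] at ih ⊢
      rw [hc] at hr
      exact .of_ev _ rfl (.ifTrue (.tail .v0)
        (.ifTrue (.call hr (.cons (.head (.head (.tail .v0))) (.head .v0)))
          (.call ih (.cons (.head .v0) (.tail (.tail .v0)))))) (by omega)
    · rw [h1, if_neg hc] at ih ⊢
      rw [Bool.eq_false_iff.2 hc] at hr
      exact .of_ev _ rfl (.ifTrue (.tail .v0)
        (.ifFalse (.call hr (.cons (.head (.head (.tail .v0))) (.head .v0)))
          (.call ih (.cons (.cons (.head (.tail .v0)) (.head .v0)) (.tail (.tail .v0))))))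
        (by omega)

theorem runs_addAllInfos {S : Finset (Fin m)} {u : List (Σ i, Fin (ar i))}
    (hu : (u.map Sigma.fst).Nodup) {M : List (List (Σ i, Fin (ar i)))} (hM : GoodList S M) :
    Runs 13 (cons (encHist u) (enc encHist M)) (encHist (addAllInfos u M))
      ((StepBound.add (∑ i, ar i) + 40) * (M.length + 1)) := by
  induction M generalizing u with
  | nil => exact .of_ev _ rfl (.ifFalse (.tail .v0) (.head .v0)) (by simp)
  | cons h M ih =>
    have hb : (StepBound.add (∑ i, ar i) + 40) * (M.length + 1 + 1) =
        (StepBound.add (∑ i, ar i) + 40) * (M.length + 1) + StepBound.add (∑ i, ar i) + 40 := by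
      ring
    have ih := ih (nodup_addInfos (h := h) hu) fun g hg => hM g (List.mem_cons_of_mem _ hg)
    have hlen := length_le_of_nodup har (hM h List.mem_cons_self).1
    have h1 : Runs 12 (cons (encHist u) (encHist h)) (encHist (addInfos u h))
        (StepBound.add (∑ i, ar i)) :=
      (runs_addInfos har hu h).mono (Nat.mul_le_mul le_rfl (by omega))
    have heq : addAllInfos u (h :: M) = addAllInfos (addInfos u h) M := rfl
    rw [heq, List.length_cons, hb]
    exact .of_ev _ rfl (.ifTrue (.tail .v0)
      (.call ih (.cons (.call h1 (.cons (.head .v0) (.head (.tail .v0)))) (.tail (.tail .v0)))))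
      (by omega)

theorem runs_occurs {u : List (Σ i, Fin (ar i))} (hu : (u.map Sigma.fst).Nodup)
    (e : Σ i, Fin (ar i)) :
    Runs 14 (cons (encHist u) (encEntry e)) (ofBool (hasInfo e.1 u))
      (StepBound.has (∑ i, ar i) + 10) :=
  .of_ev _ rfl (.call (runs_has har hu e.1) (.cons (.head (.tail .v0)) (.head .v0))) (by omega)

theorem runs_meets {u h : List (Σ i, Fin (ar i))} (hu : (u.map Sigma.fst).Nodup)
    (hh : (h.map Sigma.fst).Nodup) :
    Runs 15 (cons (encHist u) (encHist h)) (ofBool (h.any fun e => hasInfo e.1 u))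
      (StepBound.meets (∑ i, ar i)) :=
  (runs_any rfl fun e _ => runs_occurs har hu e).mono
    (Nat.mul_le_mul (by omega) (by have := length_le_of_nodup har hh; omega))

theorem runs_clash {S : Finset (Fin m)} {u : List (Σ i, Fin (ar i))}
    (hu : (u.map Sigma.fst).Nodup) {M : List (List (Σ i, Fin (ar i)))} (hM : GoodList S M) :
    Runs 16 (cons (encHist u) (enc encHist M))
      (ofBool (M.any fun h => h.any fun e => hasInfo e.1 u))
      ((StepBound.meets (∑ i, ar i) + 40) * (M.length + 1)) :=
  runs_any rfl fun h hh => runs_meets har hu (hM h hh).1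

/-- Two filters, one collection and one scan, each linear in the number of histories. -/
theorem runs_isClosed {S : Finset (Fin m)} {M : List (List (Σ i, Fin (ar i)))}
    (hM : GoodList S M) (e : Σ i, Fin (ar i)) :
    Runs 17 (cons (enc encHist M) (encEntry e)) (ofBool (isClosed M e.1))
      (StepBound.closed (∑ i, ar i) * (M.length + 1)) := by
  have h1 := runs_filterHas har hM e.1
  have h2 := runs_filterHasnt har hM e.1
  have h3 := (runs_addAllInfos har (u := []) (by simp) (hM.filter (hasInfo e.1))).mono
    (Nat.mul_le_mul le_rfl (Nat.add_le_add_right (List.length_filter_le _ _) 1))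
  have h4 := (runs_clash har (u := addAllInfos [] (M.filter (hasInfo e.1)))
    (nodup_addAllInfos (by simp)) (hM.filter fun h => !hasInfo e.1 h)).mono
    (Nat.mul_le_mul le_rfl (Nat.add_le_add_right (List.length_filter_le _ _) 1))
  have hb : StepBound.closed (∑ i, ar i) * (M.length + 1) =
      (StepBound.has (∑ i, ar i) + 50) * (M.length + 1) +
      (StepBound.has (∑ i, ar i) + 50) * (M.length + 1) +
      (StepBound.add (∑ i, ar i) + 40) * (M.length + 1) +
      (StepBound.meets (∑ i, ar i) + 40) * (M.length + 1) + 220 * M.length + 220 := by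
    simp only [StepBound.closed]; ring
  rw [hb]
  have hd : isClosed M e.1 = !((M.filter fun h => !hasInfo e.1 h).any fun h =>
    h.any fun e' => hasInfo e'.1 (addAllInfos [] (M.filter (hasInfo e.1)))) := rfl
  rw [hd]
  cases hc : (M.filter fun h => !hasInfo e.1 h).any fun h =>
    h.any fun e' => hasInfo e'.1 (addAllInfos [] (M.filter (hasInfo e.1))) with
  | true =>
    rw [hc] at h4
    exact .of_ev _ rfl (.letIn (.call h1 (.cons (.head (.tail .v0)) (.head .v0)))
      (.ifTrue (.call h4 (.cons (.call h3 (.cons .nil .v0))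
        (.call h2 (.cons (.head (.tail .v1)) (.head .v1))))) .nil)) (by omega)
  | false =>
    rw [hc] at h4
    exact .of_ev _ rfl (.letIn (.call h1 (.cons (.head (.tail .v0)) (.head .v0)))
      (.ifFalse (.call h4 (.cons (.call h3 (.cons .nil .v0))
        (.call h2 (.cons (.head (.tail .v1)) (.head .v1))))) .tt)) (by omega)

theorem runs_candidates {S : Finset (Fin m)} {M : List (List (Σ i, Fin (ar i)))}
    (hM : GoodList S M) {h : List (Σ i, Fin (ar i))} (hh : (h.map Sigma.fst).Nodup) :
    Runs 18 (cons (enc encHist M) (encHist h)) (encHist (h.filter fun e => isClosed M e.1))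
      ((StepBound.closed (∑ i, ar i) + 40) * (∑ i, ar i + 1) * (M.length + 1)) := by
  refine (runs_filter rfl fun e _ => runs_isClosed har hM e).mono ?_
  have := length_le_of_nodup har hh
  calc _ ≤ ((StepBound.closed (∑ i, ar i) + 40) * (M.length + 1)) * (∑ i, ar i + 1) := by
        refine Nat.mul_le_mul ?_ (by omega)
        rw [Nat.add_mul]; omega
    _ = _ := by ring

end Histories

/-! ### Construction of the forest -/

section Forest

variable {m : ℕ} {ar : Fin m → ℕ}

open GameStructure

/-- The S-expression of an optional forest. -/
def encForest : Option (List (GameStructure fun i : Fin m => Fin (ar i))) → LData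
  | none => nil
  | some F => cons nil (enc encode F)

/-- `o` is a forest for `M`, or `none` if there is none. -/
def IsForestFor (M : Multiset (Multiset (Σ i, Fin (ar i))))
    (o : Option (List (GameStructure fun i : Fin m => Fin (ar i)))) : Prop :=
  (o = none → ¬ ∃ F, Realizes F M) ∧ ∀ F, o = some F → Realizes F M

/-- The tag `0` of a chance node is `nil`, so the S-expression of `some F` is at the same time that
of the chance node above `F`. -/
theorem encode_ofForest (F : List (GameStructure fun i : Fin m => Fin (ar i))) (hF : F ≠ []) :
    (ofForest F hF).encode = cons nil (enc encode F) := by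
  have h := congrArg (List.map encode) (ofFn_forest F hF)
  rw [List.map_ofFn] at h
  rw [enc, ← h]
  rfl

theorem runs_playList (har : ∀ i, 0 < ar i) {S : Finset (Fin m)}
    {M : List (List (Σ i, Fin (ar i)))} (hM : GoodList S M) (e : Σ i, Fin (ar i)) {env : List LData}
    {x y z : LExpr} {n₁ n₂ n₃ : ℕ} (h₁ : Ev env x (encInfo ar e.1) n₁)
    (h₂ : Ev env y (encEntry e) n₂) (h₃ : Ev env z (enc encHist M) n₃) :
    Ev env (.call 11 (.cons x (.call 10 (.cons y z)))) (enc encHist (playList e M))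
      ((StepBound.has (∑ i, ar i) + StepBound.del (∑ i, ar i) + 80) * (M.length + 1) +
        n₁ + n₂ + n₃ + 4) := by
  have r₁ := runs_filterContains har hM e
  have r₂ := (runs_mapDel har (hM.filter fun h => h.any fun e' => decide (e = e')) e.1).mono
    (Nat.mul_le_mul le_rfl (Nat.add_le_add_right (List.length_filter_le _ _) 1))
  have hb : (StepBound.has (∑ i, ar i) + StepBound.del (∑ i, ar i) + 80) * (M.length + 1) =
      (StepBound.has (∑ i, ar i) + 40) * (M.length + 1) +
      (StepBound.del (∑ i, ar i) + 40) * (M.length + 1) := by ring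
  rw [hb]
  exact Ev.mono (.call r₂ (.cons h₁ (.call r₁ (.cons h₂ h₃)))) (by omega)

/-- The numeral `a` counts up and forms the entry of the current action, while `b` counts down and
ends the loop. An empty forest counts as failure: a player node needs a subtree for each of its
actions. -/
theorem runs_actions (har : ∀ i, 0 < ar i) {S : Finset (Fin m)}
    {M : List (List (Σ i, Fin (ar i)))} (hM : GoodList S M) (j : Fin m) {c : Fin (ar j) → ℕ}
    {o : Fin (ar j) → Option (List (GameStructure fun i : Fin m => Fin (ar i)))}
    (ho : ∀ a, Runs 20 (enc encHist (playList ⟨j, a⟩ M)) (encForest (o a)) (c a))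
    (b a : ℕ) (hab : a + b = ar j) :
    ∃ y, Runs 19 (cons (encInfo ar j) (cons (ofNat a) (cons (ofNat b) (enc encHist M)))) y
        ((((List.finRange (ar j)).drop a).map fun a => c a +
          ((StepBound.has (∑ i, ar i) + StepBound.del (∑ i, ar i) + 80) * (M.length + 1) + 100)).sum
            + 20) ∧
      ((y = nil ∧ ∃ a, o a = none ∨ o a = some []) ∨
        ((∀ a' ∈ (List.finRange (ar j)).drop a, ∃ F, o a' = some F ∧ F ≠ []) ∧
          y = cons nil (enc (fun a' => cons nil (enc encode ((o a').getD [])))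
            ((List.finRange (ar j)).drop a)))) := by
  induction b generalizing a with
  | zero =>
    have hd : (List.finRange (ar j)).drop a = [] := List.drop_eq_nil_of_le (by simp; omega)
    rw [hd]
    exact ⟨_, .of_ev _ rfl (.ifFalse (.head (.tail (.tail .v0))) .tt) (by simp),
      Or.inr ⟨by simp, rfl⟩⟩
  | succ b ih =>
    have ha : a < ar j := by omega
    have hd : (List.finRange (ar j)).drop a =
        (⟨a, ha⟩ : Fin (ar j)) :: (List.finRange (ar j)).drop (a + 1) := by
      rw [List.drop_eq_getElem_cons (by simpa using ha)]
      simp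
    rw [hd]
    simp only [List.map_cons, List.sum_cons]
    obtain ⟨y, hy, hy'⟩ := ih (a + 1) (by omega)
    have hf := ho ⟨a, ha⟩
    have hp := runs_playList har hM ⟨j, ⟨a, ha⟩⟩
      (env := [cons (encInfo ar j) (cons (ofNat a) (cons (ofNat (b + 1)) (enc encHist M)))])
      (.head .v0) (.cons (.head .v0) (.head (.tail .v0))) (.tail (.tail (.tail .v0)))
    rcases hoa : o ⟨a, ha⟩ with _ | F
    · rw [hoa] at hf
      exact ⟨nil, .of_ev _ rfl (.ifTrue (.head (.tail (.tail .v0)))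
        (.letIn (.call hf hp) (.ifFalse .v0 .nil))) (by omega), Or.inl ⟨rfl, _, Or.inl hoa⟩⟩
    · rw [hoa] at hf
      rcases F with _ | ⟨T, F⟩
      · exact ⟨nil, .of_ev _ rfl (.ifTrue (.head (.tail (.tail .v0)))
          (.letIn (.call hf hp) (.ifTrue .v0 (.ifFalse (.tail .v0) .nil)))) (by omega),
          Or.inl ⟨rfl, _, Or.inr hoa⟩⟩
      · rcases hy' with ⟨rfl, hbad⟩ | ⟨hall, rfl⟩
        · refine ⟨nil, .of_ev _ rfl (.ifTrue (.head (.tail (.tail .v0)))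
            (.letIn (.call hf hp) (.ifTrue .v0 (.ifTrue (.tail .v0) (.letIn
              (.call hy (.cons (.head .v1) (.cons (.cons .nil (.head (.tail .v1)))
                (.cons (.tail (.head (.tail (.tail .v1)))) (.tail (.tail (.tail .v1)))))))
              (.ifFalse .v0 .nil)))))) (by omega), Or.inl ⟨rfl, hbad⟩⟩
        · refine ⟨_, .of_ev _ rfl (.ifTrue (.head (.tail (.tail .v0)))
            (.letIn (.call hf hp) (.ifTrue .v0 (.ifTrue (.tail .v0) (.letIn
              (.call hy (.cons (.head .v1) (.cons (.cons .nil (.head (.tail .v1)))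
                (.cons (.tail (.head (.tail (.tail .v1)))) (.tail (.tail (.tail .v1)))))))
              (.ifTrue .v0 (.cons .nil (.cons (.cons .nil (.tail .v1)) (.tail .v0))))))))) (by omega),
            Or.inr ⟨?_, ?_⟩⟩
          · intro a' ha'
            rcases List.mem_cons.1 ha' with rfl | ha'
            · exact ⟨_, hoa, by simp⟩
            · exact hall a' ha'
          · simp only [enc, List.map_cons, ofList, hoa, Option.getD_some]

/-- Induction on `|M| + |S|`: an empty history is removed from `M`, or a closed `j` from `S`. The
potential `|M| * (|S| + 1)` pays for the time: one level uses up `|M|`, and the parts together are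
left with `|M| * |S|`. -/
theorem runs_forest (har : ∀ i, 0 < ar i) (n : ℕ) (S : Finset (Fin m))
    (M : List (List (Σ i, Fin (ar i)))) (hM : GoodList S M) (hn : M.length + S.card ≤ n) :
    ∃ o, Runs 20 (enc encHist M) (encForest o)
        (StepBound.forest (∑ i, ar i) * (M.length * (S.card + 1)) + 10) ∧
      IsForestFor (toBag M) o := by
  have hne : ∀ i, Nonempty (Fin (ar i)) := fun i => ⟨⟨0, har i⟩⟩
  induction n generalizing S M with
  | zero =>
    have : M = [] := List.eq_nil_of_length_eq_zero (by omega)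
    subst this
    exact ⟨some [], .of_ev _ rfl (.ifFalse .v0 .tt) (by omega), by simp, fun F hF => by
      cases hF; exact ⟨by simp [ForestALR], rfl⟩⟩
  | succ n ih =>
    rcases M with _ | ⟨h, M⟩
    · exact ⟨some [], .of_ev _ rfl (.ifFalse .v0 .tt) (by omega), by simp, fun F hF => by
        cases hF; exact ⟨by simp [ForestALR], rfl⟩⟩
    rcases h with _ | ⟨e₀, h⟩
    · obtain ⟨o, ho, hspec⟩ := ih S M (fun g hg => hM g (List.mem_cons_of_mem _ hg))
        (by simp only [List.length_cons] at hn; omega)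
      -- The removed empty history pays for the constant overhead of its leaf.
      have hb : StepBound.forest (∑ i, ar i) * (M.length * (S.card + 1)) + 100 ≤
          StepBound.forest (∑ i, ar i) * ((M.length + 1) * (S.card + 1)) := by
        have h1 : 100 ≤ StepBound.forest (∑ i, ar i) := by
          simp only [StepBound.forest]; omega
        have h2 : StepBound.forest (∑ i, ar i) * ((M.length + 1) * (S.card + 1)) =
          StepBound.forest (∑ i, ar i) * (M.length * (S.card + 1)) +
          StepBound.forest (∑ i, ar i) * S.card + StepBound.forest (∑ i, ar i) := by ring
        omega
      rcases o with _ | F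
      · refine ⟨none, .of_ev _ rfl (.ifTrue .v0 (.ifFalse (.head .v0)
          (.letIn (.call ho (.tail .v0)) (.ifFalse .v0 .nil))))
          (by simp only [List.length_cons]; omega), fun _ ⟨F, hF⟩ => ?_, by simp⟩
        exact hspec.1 rfl hF.remove_leaf
      · refine ⟨some (leaf :: F), .of_ev _ rfl (.ifTrue .v0 (.ifFalse (.head .v0)
          (.letIn (.call ho (.tail .v0))
            (.ifTrue .v0 (.cons .nil (.cons .nil (.tail .v0)))))))
          (by simp only [List.length_cons]; omega), by simp, fun F' hF' => ?_⟩
        cases hF'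
        exact (hspec.2 F rfl).add_leaf
    · set H := e₀ :: h with hH
      set M' := H :: M with hM'
      have hHM : H ∈ M' := List.mem_cons_self
      have hcand := runs_candidates har hM (hM H hHM).1
      have hlen : M'.length = M.length + 1 := rfl
      set K := ∑ i, ar i with hK
      set A := (StepBound.closed K + 40) * (K + 1) * (M'.length + 1) with hA
      set C := StepBound.has K + StepBound.del K + 80 with hC
      -- The local cost of one level: candidates, two filters by `j`, and the loop over at most `K`
      -- actions without the recursive calls.
      have hlev : A + (StepBound.has K + 50) * (M'.length + 1) +
          (StepBound.has K + 50) * (M'.length + 1) + K * (C * (M'.length + 1) + 100) + 20 * K + 300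
          ≤ StepBound.forest K * M'.length := by
        have h1 : A + (StepBound.has K + 50) * (M'.length + 1) +
          (StepBound.has K + 50) * (M'.length + 1) + K * (C * (M'.length + 1) + 100) + 20 * K + 300
          ≤ StepBound.level K * (M'.length + 1) := by
          have : StepBound.level K * (M'.length + 1) = A + (StepBound.has K + 50) * (M'.length + 1) +
            (StepBound.has K + 50) * (M'.length + 1) + K * (C * (M'.length + 1)) +
            (220 * K + (StepBound.has K + StepBound.del K + 300) + 300) * (M'.length + 1) := by
            simp only [StepBound.level, hA, hC]; ring
          rw [this]
          have h3 : 220 * K + 300 ≤ (220 * K + (StepBound.has K + StepBound.del K + 300) + 300) *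
              (M'.length + 1) := by
            refine le_trans ?_ (Nat.le_mul_of_pos_right _ (Nat.succ_pos _)); omega
          have h4 : K * (C * (M'.length + 1) + 100) = K * (C * (M'.length + 1)) + 100 * K := by ring
          omega
        -- `M'` is non-empty, so its length plus one is at most twice its length; hence the factor 2
        -- in `StepBound.forest`.
        have h2 : StepBound.level K * (M'.length + 1) ≤ StepBound.forest K * M'.length := by
          have : StepBound.level K * (M'.length + 1) ≤ StepBound.level K * (2 * M'.length) :=
            Nat.mul_le_mul le_rfl (by omega)
          have h5 : StepBound.forest K * M'.length = StepBound.level K * (2 * M'.length) +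
            100 * (K + 1) * M'.length := by simp only [StepBound.forest]; ring
          omega
        exact h1.trans h2
      have htot : StepBound.forest K * (M'.length * (S.card + 1)) =
          StepBound.forest K * M'.length + StepBound.forest K * (M'.length * S.card) := by ring
      rcases hl : H.filter (fun e => isClosed M' e.1) with _ | ⟨e, l⟩
      · rw [hl] at hcand
        refine ⟨none, .of_ev _ rfl (.ifTrue .v0 (.ifTrue (.head .v0)
          (.letIn (.call hcand (.cons .v0 (.head .v0))) (.ifFalse .v0 .nil)))) (by omega),
          fun _ ⟨F, hF⟩ => ?_, by simp⟩
        -- A realization would supply a closed entry of the first history, but none passed the test.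
        obtain ⟨e, he, hc⟩ := hF.exists_closed (x := (H : Multiset (Σ i, Fin (ar i))))
          (mem_toBag.2 ⟨H, hHM, rfl⟩) (by simp [hH])
        exact List.filter_eq_nil_iff.1 hl e he (isClosed_iff.2 hc)
      · rw [hl] at hcand
        obtain ⟨heH, hec⟩ := List.mem_filter.1 (hl ▸ (List.mem_cons_self : e ∈ e :: l))
        obtain ⟨j, a₀⟩ := e
        have hclosed := isClosed_iff.1 hec
        have hjS : j ∈ S := (hM H hHM).2 _ heH
        have hSc : (S.erase j).card + 1 = S.card := Finset.card_erase_add_one hjS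
        obtain ⟨oN, hoN, hsN⟩ := ih (S.erase j) _ (hM.filter_erase j) (by
          have := List.length_filter_le (fun h => !hasInfo j h) M'; omega)
        have hA' : ∀ a : Fin (ar j), ∃ o, Runs 20 (enc encHist (playList ⟨j, a⟩ M')) (encForest o)
            (StepBound.forest K * ((playList ⟨j, a⟩ M').length * S.card) + 10) ∧
            IsForestFor (toBag (playList ⟨j, a⟩ M')) o := by
          intro a
          have := ih (S.erase j) _ (hM.playList ⟨j, a⟩) (by
            have : (playList ⟨j, a⟩ M').length ≤ M'.length := by
              rw [playList, List.length_map]; exact List.length_filter_le _ _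
            omega)
          rwa [hSc] at this
        choose o ho hs using hA'
        have hY := hM.filter (hasInfo j)
        obtain ⟨y, hy, hspec⟩ := runs_actions har hY j (o := o)
          (fun a => by rw [playList_filter]; exact ho a) (ar j) 0 (by omega)
        rw [hSc] at hoN
        have hsum := sum_length_playList hM j
        have hYl := List.length_filter_le (hasInfo j) M'
        have hcost : (((List.finRange (ar j)).drop 0).map fun a =>
            (StepBound.forest K * ((playList ⟨j, a⟩ M').length * S.card) + 10) +
            (C * ((M'.filter (hasInfo j)).length + 1) + 100)).sum ≤
            StepBound.forest K * ((∑ a : Fin (ar j), (playList ⟨j, a⟩ M').length) * S.card) +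
            K * (C * (M'.length + 1) + 100) + 10 * K := by
          rw [List.drop_zero, ← Fin.sum_univ_def, Finset.sum_add_distrib, Finset.sum_add_distrib,
            ← Finset.mul_sum, ← Finset.sum_mul]
          simp only [Finset.sum_const, Finset.card_univ, Fintype.card_fin, smul_eq_mul]
          have hj : ar j ≤ K := arity_le_sum j
          have : ar j * (C * ((M'.filter (hasInfo j)).length + 1) + 100) ≤
              K * (C * (M'.length + 1) + 100) :=
            Nat.mul_le_mul hj (Nat.add_le_add_right (Nat.mul_le_mul le_rfl (by omega)) _)
          omega
        rw [← hK, ← hC] at hy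
        replace hy := hy.mono (Nat.add_le_add_right hcost 20)
        -- The potential left for the recursive calls splits exactly along the parts.
        have hcost2 : StepBound.forest K * (M'.length * S.card) =
            StepBound.forest K * ((∑ a : Fin (ar j), (playList ⟨j, a⟩ M').length) * S.card) +
            StepBound.forest K * ((M'.filter fun h => !hasInfo j h).length * S.card) := by
          rw [← hsum]; ring
        have hfN := runs_filterHasnt har hM j
        have hfY := runs_filterHas har hM j
        rw [← hK] at hfN hfY
        have hex : ∃ x ∈ toBag M', j ∈ infos x :=
          ⟨_, mem_toBag.2 ⟨H, hHM, rfl⟩, hasInfo_iff.1 (List.any_eq_true.2 ⟨_, heH, by simp⟩)⟩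
        have hNbag : toBag (M'.filter fun h => !hasInfo j h) =
            (toBag M').filter fun x => j ∉ infos x :=
          toBag_filter _ _ _ fun l => by rw [← hasInfo_iff]; simp
        rw [hNbag] at hsN
        rcases oN with _ | FN
        · refine ⟨none, .of_ev _ rfl (.ifTrue .v0 (.ifTrue (.head .v0)
            (.letIn (.call hcand (.cons .v0 (.head .v0))) (.ifTrue .v0
              (.letIn (.head (.head .v0)) (.letIn (.call hoN (.call hfN (.cons .v0 .v2)))
                (.ifFalse .v0 .nil))))))) (by omega), fun _ ⟨F, hF⟩ => ?_, by simp⟩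
          exact hsN.1 rfl (hF.split hclosed).2
        · rcases hspec with ⟨rfl, a, hbad⟩ | ⟨hall, rfl⟩
          · refine ⟨none, .of_ev _ rfl (.ifTrue .v0 (.ifTrue (.head .v0)
              (.letIn (.call hcand (.cons .v0 (.head .v0))) (.ifTrue .v0
                (.letIn (.head (.head .v0)) (.letIn (.call hoN (.call hfN (.cons .v0 .v2)))
                  (.ifTrue .v0 (.letIn (.call hy (.cons .v1 (.cons .nil (.cons (.tail .v1)
                    (.call hfY (.cons .v1 .v3))))))
                    (.ifFalse .v0 .nil))))))))) (by omega), fun _ ⟨F, hF⟩ => ?_, by simp⟩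
            -- A realization of `M'` would make the part for `a` both realizable and non-empty,
            -- which excludes a missing forest and an empty one.
            have hp := hF.play hclosed hM.nodup_infos hex a
            rw [← toBag_playList] at hp
            rcases hbad with hbad | hbad
            · exact (hs a).1 hbad hp.2
            · exact hp.1 ((hs a).2 [] hbad).2.symm
          · have hall' : ∀ a, ∃ F, o a = some F ∧ F ≠ [] := fun a => hall a (by simp)
            choose FA hFA hFne using hall'
            have hyeq : enc (fun a => cons nil (enc encode ((o a).getD [])))
                ((List.finRange (ar j)).drop 0) =
                ofList (List.ofFn fun a => (ofForest (FA a) (hFne a)).encode) := by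
              rw [enc, List.drop_zero, List.ofFn_eq_map]
              congr 1
              refine List.map_congr_left fun a _ => ?_
              rw [encode_ofForest, hFA, Option.getD_some]
            rw [hyeq] at hy
            -- The first component of `encInfo ar j` is the numeral `j + 1`, the tag of a player
            -- node; the forests found for the actions already encode the chance nodes below it.
            have hfin : Ev [cons nil (ofList (List.ofFn fun a => (ofForest (FA a) (hFne a)).encode)),
                encForest (some FN), encInfo ar j, encHist (⟨j, a₀⟩ :: l), enc encHist M']
                (.cons .nil (.cons (.cons (.head (.var 2)) (.tail (.var 0))) (.tail (.var 1))))
                (encForest (some (player j (fun a => ofForest (FA a) (hFne a)) :: FN))) 10 :=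
              .cons .nil (.cons (.cons (.head .v2) (.tail .v0)) (.tail .v1))
            refine ⟨some (player j (fun a => ofForest (FA a) (hFne a)) :: FN), .of_ev _ rfl
              (.ifTrue .v0 (.ifTrue (.head .v0)
              (.letIn (.call hcand (.cons .v0 (.head .v0))) (.ifTrue .v0
                (.letIn (.head (.head .v0)) (.letIn (.call hoN (.call hfN (.cons .v0 .v2)))
                  (.ifTrue .v0 (.letIn (.call hy (.cons .v1 (.cons .nil (.cons (.tail .v1)
                    (.call hfY (.cons .v1 .v3)))))) (.ifTrue .v0 hfin)))))))))
              (by omega), by simp, fun F hF => ?_⟩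
            cases hF
            refine realizes_cons_player hclosed hM.nodup_infos (hsN.2 FN rfl) hFne fun a => ?_
            rw [← toBag_playList]
            exact (hs a).2 _ (hFA a)

end Forest

/-! ### Collecting the leaf histories -/

namespace GameStructure

variable {ι : Type} {Act : ι → Type} [∀ i, Fintype (Act i)]

/-- The number of nodes. -/
def numNodes : GameStructure Act → ℕ
  | leaf => 1
  | player _ child => 1 + ∑ a, (child a).numNodes
  | chance _ child => 1 + ∑ j, (child j).numNodes

theorem numNodes_pos (T : GameStructure Act) : 0 < T.numNodes := by
  cases T <;> simp only [numNodes] <;> omega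

theorem card_bag_pos [∀ i, Nonempty (Act i)] (T : GameStructure Act) : 0 < T.bag.card := by
  obtain ⟨x, hx⟩ := exists_mem_bag T
  exact Multiset.card_pos_iff_exists_mem.2 ⟨x, hx⟩

/-- The extra 1 on the left is gained once per child: a chance node with two or more children is
paid for in this way, a player node by lowering `d`, and a unary chance node by its own term on the
right. -/
theorem numNodes_add_one_le [∀ i, Nonempty (Act i)] (T : GameStructure Act) (d : ℕ)
    (hd : ∀ x ∈ T.bag, x.card ≤ d) :
    T.numNodes + 1 ≤ (d + 2) * (T.bag.card + T.numUnaryChance) := by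
  induction T generalizing d with
  | leaf => simp [numNodes, bag, numUnaryChance]
  | player i child ih =>
    -- Every history below a player node is non-empty, so `d` is positive and the children satisfy
    -- the bound with `d - 1`.
    obtain ⟨d, rfl⟩ : ∃ d', d = d' + 1 := by
      obtain ⟨x, hx⟩ := exists_mem_bag (player i child)
      have := hd x hx
      obtain ⟨a, y, _, rfl⟩ := mem_bag_player.1 hx
      rw [Multiset.card_cons] at this
      exact ⟨d - 1, by omega⟩
    have ih' : ∀ a, (child a).numNodes + 1 ≤
        (d + 2) * ((child a).bag.card + (child a).numUnaryChance) := fun a => ih a d fun y hy => by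
      have := hd _ (mem_bag_player.2 ⟨a, y, hy, rfl⟩)
      rw [Multiset.card_cons] at this
      omega
    have hsum := Finset.sum_le_sum fun a (_ : a ∈ Finset.univ) => ih' a
    rw [← Finset.mul_sum, Finset.sum_add_distrib, Finset.sum_add_distrib] at hsum
    have hcard : (player i child).bag.card = ∑ a, (child a).bag.card := by
      simp [bag, Multiset.card_sum]
    have h1 : ∑ _a : Act i, 1 = Fintype.card (Act i) := by simp
    have hpos : 0 < Fintype.card (Act i) := Fintype.card_pos
    have hc := card_bag_pos (player i child)
    rw [hcard] at hc ⊢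
    rw [numNodes, numUnaryChance]
    have : (d + 1 + 2) * (∑ a, (child a).bag.card + ∑ a, (child a).numUnaryChance) =
        (d + 2) * (∑ a, (child a).bag.card + ∑ a, (child a).numUnaryChance) +
        ∑ a, (child a).bag.card + ∑ a, (child a).numUnaryChance := by ring
    omega
  | chance n child ih =>
    have ih' := fun j => ih j d fun y hy => hd _ (mem_bag_chance.2 ⟨j, hy⟩)
    have hsum := Finset.sum_le_sum fun j (_ : j ∈ Finset.univ) => ih' j
    rw [← Finset.mul_sum, Finset.sum_add_distrib, Finset.sum_add_distrib] at hsum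
    have hcard : (chance n child).bag.card = ∑ j, (child j).bag.card := by
      simp [bag, Multiset.card_sum]
    have h1 : ∑ _j : Fin (n + 1), 1 = n + 1 := by simp
    rw [hcard, numNodes, numUnaryChance]
    split_ifs with hn
    · have : (d + 2) * (∑ j, (child j).bag.card + (1 + ∑ j, (child j).numUnaryChance)) =
          (d + 2) * (∑ j, (child j).bag.card + ∑ j, (child j).numUnaryChance) + d + 2 := by ring
      omega
    · rw [zero_add]; omega

end GameStructure

section Gather

variable {m : ℕ} {ar : Fin m → ℕ}

open GameStructure

/-- The gathering function is correct and fast on `T`. -/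
def Gathers (T : GameStructure fun i : Fin m => Fin (ar i)) : Prop :=
  ∀ (h : List (Σ i, Fin (ar i))) (M : List (List (Σ i, Fin (ar i)))), ∃ L,
    Runs 22 (cons T.encode (cons (encHist h) (enc encHist M))) (enc encHist L)
        (200 * T.numNodes - 100) ∧
      toBag L = T.bag.map (fun x => x + Multiset.ofList h) + toBag M

theorem runs_gatherChance (l : List (GameStructure fun i : Fin m => Fin (ar i)))
    (hl : ∀ T ∈ l, Gathers T) (h : List (Σ i, Fin (ar i))) (M : List (List (Σ i, Fin (ar i)))) :
    ∃ L, Runs 24 (cons (enc encode l) (cons (encHist h) (enc encHist M))) (enc encHist L)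
        (200 * (l.map numNodes).sum + 20) ∧
      toBag L = (l.map bag).sum.map (fun x => x + Multiset.ofList h) + toBag M := by
  induction l with
  | nil =>
    exact ⟨M, .of_ev _ rfl (.ifFalse (.head .v0) (.tail (.tail .v0))) (by simp), by simp⟩
  | cons T l ih =>
    obtain ⟨L₁, h₁, hb₁⟩ := ih fun U hU => hl U (List.mem_cons_of_mem _ hU)
    obtain ⟨L₂, h₂, hb₂⟩ := hl T List.mem_cons_self h L₁
    have hn := numNodes_pos T
    refine ⟨L₂, .of_ev _ rfl (.ifTrue (.head .v0) (.call h₂ (.cons (.head (.head .v0))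
      (.cons (.head (.tail .v0)) (.call h₁ (.cons (.tail (.head .v0)) (.tail .v0)))))))
      (by simp only [List.map_cons, List.sum_cons]; omega), ?_⟩
    rw [hb₂, hb₁, List.map_cons, List.sum_cons, Multiset.map_add, add_assoc]

theorem runs_gatherPlayer (i : Fin m) (f : Fin (ar i) → GameStructure fun i : Fin m => Fin (ar i))
    (hf : ∀ a, Gathers (f a)) (h : List (Σ i, Fin (ar i)))
    (M : List (List (Σ i, Fin (ar i)))) (b a : ℕ) (hab : a + b = ar i) :
    ∃ L, Runs 23 (cons (cons (encInfo ar i) (ofNat a))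
        (cons (enc (fun a => (f a).encode) ((List.finRange (ar i)).drop a))
          (cons (encHist h) (enc encHist M)))) (enc encHist L)
        (((((List.finRange (ar i)).drop a).map fun a => (200 * (f a).numNodes - 20)).sum + 20)) ∧
      toBag L = (((List.finRange (ar i)).drop a).map fun a => (f a).bag.map
        (fun x => x + Multiset.ofList (⟨i, a⟩ :: h))).sum + toBag M := by
  induction b generalizing a with
  | zero =>
    have hd : (List.finRange (ar i)).drop a = [] := List.drop_eq_nil_of_le (by simp; omega)
    rw [hd]
    exact ⟨M, .of_ev _ rfl (.ifFalse (.head (.tail .v0)) (.tail (.tail (.tail .v0))))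
      (by simp), by simp⟩
  | succ b ih =>
    have ha : a < ar i := by omega
    have hd : (List.finRange (ar i)).drop a =
        (⟨a, ha⟩ : Fin (ar i)) :: (List.finRange (ar i)).drop (a + 1) := by
      rw [List.drop_eq_getElem_cons (by simpa using ha)]
      simp
    rw [hd]
    obtain ⟨L₁, h₁, hb₁⟩ := ih (a + 1) (by omega)
    obtain ⟨L₂, h₂, hb₂⟩ := hf ⟨a, ha⟩ (⟨i, ⟨a, ha⟩⟩ :: h) L₁
    have hn := numNodes_pos (f ⟨a, ha⟩)
    refine ⟨L₂, .of_ev _ rfl (.ifTrue (.head (.tail .v0)) (.call h₂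
      (.cons (.head (.head (.tail .v0))) (.cons (.cons (.head .v0) (.head (.tail (.tail .v0))))
        (.call h₁ (.cons (.cons (.head (.head .v0)) (.cons .nil (.tail (.head .v0))))
          (.cons (.tail (.head (.tail .v0))) (.tail (.tail .v0)))))))))
      (by simp only [List.map_cons, List.sum_cons]; omega), ?_⟩
    rw [hb₂, hb₁, List.map_cons, List.sum_cons, add_assoc]

/-- The prefix `h` is shared and `M` is an accumulator, so no list is copied and the work is linear
in the number of nodes. Histories come out reversed, which `toBag` does not see. -/
theorem gathers (T : GameStructure fun i : Fin m => Fin (ar i)) : Gathers T := by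
  induction T with
  | leaf =>
    intro h M
    exact ⟨h :: M, .of_ev _ rfl (.ifFalse (.head .v0) (.tail .v0)) (by simp [numNodes]), by simp [bag, toBag_cons, Multiset.singleton_add]⟩
  | player i f ih =>
    intro h M
    obtain ⟨L, hL, hb⟩ := runs_gatherPlayer i f ih h M (ar i) 0 (by omega)
    -- The arity of `i` is read off the number of children and stored in each entry, so that the
    -- forest construction knows how many actions to try.
    have hlen := runs_length (f := fun a => (f a).encode) (List.finRange (ar i))
    rw [List.length_finRange] at hlen
    rw [List.drop_zero] at hL hb
    have henc : (player i f).encode =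
        cons (ofNat (i.val + 1)) (enc (fun a => (f a).encode) (List.finRange (ar i))) := by
      rw [encode, List.ofFn_eq_map, enc]
    rw [← Fin.sum_univ_def] at hL hb
    -- The 20 steps saved per child pay for counting the children.
    have hsum : ∑ a, (200 * (f a).numNodes - 20) + 20 * ar i = 200 * ∑ a, (f a).numNodes := by
      have : 20 * ar i = ∑ _a : Fin (ar i), 20 := by simp [mul_comm]
      rw [this, ← Finset.sum_add_distrib, Finset.mul_sum]
      refine Finset.sum_congr rfl fun a _ => ?_
      have := numNodes_pos (f a)
      omega
    refine ⟨L, ?_, ?_⟩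
    · rw [henc]
      exact .of_ev _ rfl (.ifTrue (.head .v0) (.ifTrue (.head (.head .v0)) (.call hL
        (.cons (.cons (.cons (.head (.head .v0)) (.call hlen (.tail (.head .v0)))) .nil)
          (.cons (.tail (.head .v0)) (.tail .v0)))))) (by rw [numNodes]; omega)
    · rw [hb, bag, map_sum']
      congr 1
      refine Finset.sum_congr rfl fun a _ => ?_
      rw [Multiset.map_map]
      refine Multiset.map_congr rfl fun x _ => ?_
      rw [Function.comp, ← Multiset.cons_coe, Multiset.add_cons, Multiset.cons_add]
  | chance n f ih =>
    intro h M
    obtain ⟨L, hL, hb⟩ := runs_gatherChance (List.ofFn f)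
      (fun T hT => by obtain ⟨a, rfl⟩ := List.mem_ofFn.1 hT; exact ih a) h M
    have henc : (chance n f).encode = cons nil (enc encode (List.ofFn f)) := by
      rw [encode, enc, List.map_ofFn]; rfl
    refine ⟨L, ?_, ?_⟩
    · rw [List.map_ofFn, List.sum_ofFn] at hL
      simp only [Function.comp] at hL
      rw [henc]
      exact .of_ev _ rfl (.ifTrue (.head .v0) (.ifFalse (.head (.head .v0)) (.call hL
        (.cons (.tail (.head .v0)) (.tail .v0))))) (by rw [numNodes]; omega)
    · rw [hb, bag, List.map_ofFn, List.sum_ofFn]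
      rfl

end Gather

/-- One program `P` decides shuffled A-loss recall on all non-absentminded one-player game
structures `T` over all finite alphabets (`m` information sets, the `i`-th with `ar i ≥ 1`
actions).  It answers `nil` if `T` does not have shuffled A-loss recall, and otherwise outputs a
witness structure.  With `|A| = ∑ i, ar i` actions in all, it takes at most `p(|A|) * |T|` steps if
no chance node of `T` has a single outgoing edge; such nodes are counted like leaves. -/
theorem mainTheorem3 :
    ∃ (P : LProgram) (p : Polynomial ℕ),
      ∀ (m : ℕ) (ar : Fin m → ℕ), (∀ i, 0 < ar i) →
        ∀ T : GameStructure (fun i : Fin m => Fin (ar i)), T.NonAbsentminded →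
          ∃ (y : LData) (n : ℕ), P.HaltsWith T.encode y n ∧
            n ≤ p.eval (∑ i, ar i) * (T.size + T.numUnaryChance) ∧
            (¬ T.HasShuffledALossRecall → y = LData.nil) ∧
            (T.HasShuffledALossRecall →
              ∃ T' : GameStructure (fun i : Fin m => Fin (ar i)),
                T.IsShuffledWitness T' ∧ y = LData.cons LData.nil T'.encode) := by
  refine ⟨alrProgram, StepBound.total Polynomial.X, fun m ar har T hT => ?_⟩
  rw [StepBound.eval_total]
  have hne : ∀ i, Nonempty (Fin (ar i)) := fun i => ⟨⟨0, har i⟩⟩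
  obtain ⟨L, hL, hbag⟩ := gathers T [] []
  have hbag : GameStructure.toBag L = T.bag := by
    rw [hbag]; simp [GameStructure.toBag]
  have hgood : GameStructure.GoodList Finset.univ L := by
    intro h hh
    refine ⟨?_, fun e _ => Finset.mem_univ _⟩
    have := GameStructure.nodup_infos_of_mem_bag hT
      (hbag ▸ GameStructure.mem_toBag.2 ⟨h, hh, rfl⟩ : (h : Multiset _) ∈ T.bag)
    simpa [GameStructure.infos] using this
  have hlen : L.length = T.size := by
    rw [← GameStructure.card_bag, ← hbag]; simp [GameStructure.toBag]
  obtain ⟨o, ho, hspec⟩ := runs_forest har _ Finset.univ L hgood le_rfl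
  rw [hbag] at hspec
  have hpos := GameStructure.card_bag_pos T
  have hm := card_le_sum har
  have hnodes := GameStructure.numNodes_add_one_le T (∑ i, ar i) fun x hx => by
    have h := GameStructure.nodup_infos_of_mem_bag hT hx
    have := Finset.card_le_univ (⟨_, h⟩ : Finset (Fin m))
    simp only [Finset.card_mk, GameStructure.infos, Multiset.card_map, Fintype.card_fin] at this
    exact this.trans hm
  rw [GameStructure.card_bag] at hnodes hpos
  rw [hlen, Finset.card_univ, Fintype.card_fin] at ho
  -- Gathering is charged to nodes and hence, by `hnodes`, to leaves and unary chance nodes; the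
  -- forest is charged to leaves, with `m` replaced by the number of actions.
  have hcost : 200 * T.numNodes - 100 + (StepBound.forest (∑ i, ar i) * (T.size * (m + 1)) + 10) + 50 ≤
      StepBound.total (∑ i, ar i) * (T.size + T.numUnaryChance) := by
    have h1 : StepBound.total (∑ i, ar i) * (T.size + T.numUnaryChance) =
        StepBound.forest (∑ i, ar i) * (T.size * (∑ i, ar i + 1)) +
        StepBound.forest (∑ i, ar i) * (∑ i, ar i + 1) * T.numUnaryChance +
        200 * ((∑ i, ar i + 2) * (T.size + T.numUnaryChance)) +
        100 * (T.size + T.numUnaryChance) := by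
      simp only [StepBound.total]; ring
    have h2 : StepBound.forest (∑ i, ar i) * (T.size * (m + 1)) ≤
        StepBound.forest (∑ i, ar i) * (T.size * (∑ i, ar i + 1)) :=
      Nat.mul_le_mul le_rfl (Nat.mul_le_mul le_rfl (by omega))
    omega
  -- The two extra steps are the initial call and the evaluation of its argument.
  have hstart : ∀ {y n}, Runs 0 T.encode y n →
      n + 2 ≤ StepBound.total (∑ i, ar i) * (T.size + T.numUnaryChance) →
      ∃ n, alrProgram.HaltsWith T.encode y n ∧
        n ≤ StepBound.total (∑ i, ar i) * (T.size + T.numUnaryChance) := by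
    intro y n h hn
    obtain ⟨k, hk, h⟩ := Ev.call h Ev.v0
    exact ⟨k, h, by omega⟩
  rcases o with _ | F
  · obtain ⟨n, h, hn⟩ := hstart (.of_ev _ rfl (.letIn (.call ho (.call hL
      (.cons .v0 (.cons .nil .nil)))) (.ifFalse .v0 .nil)) le_rfl) (by omega)
    exact ⟨_, n, h, hn, fun _ => rfl, fun hs => absurd hs.exists_realizes (hspec.1 rfl)⟩
  · obtain ⟨n, h, hn⟩ := hstart (.of_ev _ rfl (.letIn (.call ho (.call hL
      (.cons .v0 (.cons .nil .nil)))) (.ifTrue .v0 (.cons .nil (.cons .nil (.tail .v0)))))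
      le_rfl) (by omega)
    have hF := hspec.2 F rfl
    -- `T` has a leaf, so a forest for its histories is non-empty and can be put below a chance
    -- node.
    have hF0 : F ≠ [] := by
      rintro rfl
      have := congrArg Multiset.card hF.2
      rw [GameStructure.card_bag] at this
      simp at this
      omega
    have hw := hF.isShuffledWitness hF0
    exact ⟨_, n, h, hn, fun hs => absurd ⟨_, hw⟩ hs,
      fun _ => ⟨_, hw, by rw [encode_ofForest]⟩⟩
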